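/- Let $X$ be a finite set and let $\mathbb{A}_X$ be the quantum automorphism group of the rooted tree $X^*$: the universal unital $C^*$-algebra generated by elements $a_{u,v}$ ($u,v\in X^n$, $n\ge 0$) subject to $a_{\varnothing,\varnothing}=1$, $a_{u,v}^*=a_{u,v}^2=a_{u,v}$, and $a_{u,v}=\sum_{y\in X}a_{ux,vy}=\sum_{z\in X}a_{uz,vx}$ for all $u,v\in X^n$, $x\in X$, with the comultiplication $\Delta:\mathbb{A}_X\to\mathbb{A}_X\otimes\mathbb{A}_X$ (minimal tensor product), $\Delta(a_{u,v})=\sum_{w\in X^n}a_{u,w}\otimes a_{w,v}$. Let $\psi:\mathbb{C}^X\otimes\mathbb{A}_X\to\mathbb{A}_X\otimes\mathbb{C}^X$ be the self-similarity homomorphism, i.e. the unital $*$-homomorphism with $\psi(e_x\otimes a_{u,v})=\sum_{y\in X}a_{xu,yv}\otimes e_y$. A unitary representation of $\mathbb{A}_X$ on a finite-dimensional Hilbert space $\mathcal{H}$ is a unitary $u\in\mathcal{B}(\mathcal{H})\otimes\mathbb{A}_X$ with $(\mathrm{id}\otimes\Delta)(u)=u_{12}u_{13}$. An intertwiner from $u$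 (on $\mathcal{H}$) to $v$ (on $\mathcal{K}$) is a linear map $T:\mathcal{H}\to\mathcal{K}$ with $(T\otimes 1)u=v(T\otimes 1)$. (1) Let $u$ be a unitary representation of $\mathbb{A}_X$ on a finite-dimensional Hilbert space $\mathcal{H}$. Then there is a unitary representation $\psi(u)$ of $\mathbb{A}_X$ on $\mathbb{C}^X\otimes\mathcal{H}$ such that, for every orthonormal basis $(b_i)$ of $\mathcal{H}$, the matrix entries of $u$ with respect to $(b_i)$ and those of $\psi(u)$ with respect to $(e_x\otimes b_i)$ satisfy $$\psi(e_x\otimes u_{i,j})=\sum_{y\in X}\psi(u)_{(x,i),(y,j)}\otimes e_y\qquad\text{for all } x, i, j.$$ Moreover, $\psi(u)$ is the only element of $\mathcal{B}(\mathbb{C}^X\otimes\mathcal{H})\otimes\mathbb{A}_X$ that satisfies these relations for some orthonormal basis $(b_i)$ of $\mathcal{H}$. (2) If $u$ and $v$ are unitary representations of $\mathbb{A}_X$ on finite-dimensional Hilbert spaces $\mathcal{H}$ and $\mathcal{K}$, and $T:\mathcal{H}\to\mathcal{K}$ is an intertwiner from $u$ to $v$, then $\mathrm{id}_{\mathbb{C}^X}\otimes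 T$ is an intertwiner from $\psi(u)$ to $\psi(v)$. -/

import Mathlib

open scoped TensorProduct InnerProductSpace

universe u v w

/-- A `C⋆`-seminorm on a unital complex `⋆`-algebra. -/
structure CStarSeminorm (R : Type u) [Ring R] [StarRing R] [Algebra ℂ R] extends
    Seminorm ℂ R where
  mul_le' : ∀ x y, toFun (x * y) ≤ toFun x * toFun y
  mul_self_le' : ∀ x, toFun x * toFun x ≤ toFun (star x * x)

namespace CStarSeminorm

section Basic

variable {R : Type u} [Ring R] [StarRing R] [Algebra ℂ R]

instance : CoeFun (CStarSeminorm R) (fun _ => R → ℝ) := ⟨fun p => p.toFun⟩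

lemma nonneg (p : CStarSeminorm R) (x : R) : 0 ≤ p x := apply_nonneg p.toSeminorm x

lemma mul_le (p : CStarSeminorm R) (x y : R) : p (x * y) ≤ p x * p y := p.mul_le' x y

lemma mul_self_le (p : CStarSeminorm R) (x : R) : p x * p x ≤ p (star x * x) := p.mul_self_le' x

lemma le_star (p : CStarSeminorm R) (x : R) : p x ≤ p (star x) := by
  have h := (p.mul_self_le x).trans (p.mul_le (star x) x)
  rcases (p.nonneg x).eq_or_lt with h0 | h0
  · rw [← h0]; exact p.nonneg _
  · exact le_of_mul_le_mul_right h h0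

lemma star_eq (p : CStarSeminorm R) (x : R) : p (star x) = p x :=
  le_antisymm (by simpa using p.le_star (star x)) (p.le_star x)

/-- The pointwise supremum of a nonempty, pointwise bounded set of `C⋆`-seminorms. -/
noncomputable def sup (S : Set (CStarSeminorm R)) (hne : S.Nonempty)
    (hS : ∀ x, ∃ C, ∀ p ∈ S, p x ≤ C) : CStarSeminorm R :=
  haveI : Nonempty S := hne.to_subtype
  have bdd : ∀ x, BddAbove (Set.range fun p : S => p.1 x) := fun x => by
    obtain ⟨C, hC⟩ := hS x
    exact ⟨C, by rintro _ ⟨p, rfl⟩; exact hC p.1 p.2⟩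
  have nn : ∀ x, 0 ≤ ⨆ p : S, p.1 x := fun x => Real.iSup_nonneg fun p => p.1.nonneg x
  { Seminorm.of (𝕜 := ℂ) (fun x => ⨆ p : S, p.1 x)
      (fun x y => ciSup_le fun p => (map_add_le_add p.1.toSeminorm x y).trans
        (add_le_add (le_ciSup (bdd x) p) (le_ciSup (bdd y) p)))
      (fun c x => by
        rw [Real.mul_iSup_of_nonneg (norm_nonneg c)]
        exact iSup_congr fun p => map_smul_eq_mul p.1.toSeminorm c x) with
    mul_le' := fun x y => ciSup_le fun p => (p.1.mul_le x y).trans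
      (mul_le_mul (le_ciSup (bdd x) p) (le_ciSup (bdd y) p) (p.1.nonneg y) (nn x))
    mul_self_le' := fun x => by
      change (⨆ p : S, p.1 x) * (⨆ p : S, p.1 x) ≤ ⨆ p : S, p.1 (star x * x)
      have : (⨆ p : S, p.1 x) ≤ √(⨆ p : S, p.1 (star x * x)) := ciSup_le fun p =>
        Real.le_sqrt_of_sq_le (by
          rw [sq]
          exact (p.1.mul_self_le x).trans (le_ciSup (bdd (star x * x)) p))
      calc _ ≤ √(⨆ p : S, p.1 (star x * x)) * √(⨆ p : S, p.1 (star x * x)) :=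
            mul_le_mul this this (nn x) (Real.sqrt_nonneg _)
        _ = _ := Real.mul_self_sqrt (nn _) }

lemma sup_apply (S : Set (CStarSeminorm R)) (hne : S.Nonempty)
    (hS : ∀ x, ∃ C, ∀ p ∈ S, p x ≤ C) (x : R) : sup S hne hS x = ⨆ p : S, p.1 x := rfl

lemma le_sup (S : Set (CStarSeminorm R)) (hne : S.Nonempty)
    (hS : ∀ x, ∃ C, ∀ p ∈ S, p x ≤ C) {p : CStarSeminorm R} (hp : p ∈ S) (x : R) :
    p x ≤ sup S hne hS x := by
  obtain ⟨C, hC⟩ := hS x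
  exact le_ciSup (f := fun p : S => p.1 x) ⟨C, by rintro _ ⟨q, rfl⟩; exact hC q.1 q.2⟩ ⟨p, hp⟩

/-- The `C⋆`-seminorm `x ↦ ‖φ x‖` of a `⋆`-homomorphism into a `C⋆`-algebra. -/
noncomputable def ofHom {B : Type v} [CStarAlgebra B] (φ : R →⋆ₙₐ[ℂ] B) :
    CStarSeminorm R :=
  { Seminorm.of (𝕜 := ℂ) (fun x => ‖φ x‖)
      (fun x y => by rw [map_add]; exact norm_add_le _ _)
      (fun c x => by rw [map_smul, norm_smul]) with
    mul_le' := fun x y => by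
      change ‖φ (x * y)‖ ≤ ‖φ x‖ * ‖φ y‖
      rw [map_mul]; exact norm_mul_le _ _
    mul_self_le' := fun x => by
      change ‖φ x‖ * ‖φ x‖ ≤ ‖φ (star x * x)‖
      rw [map_mul, map_star, CStarRing.norm_star_mul_self] }

lemma ofHom_apply {B : Type v} [CStarAlgebra B] (φ : R →⋆ₙₐ[ℂ] B) (x : R) :
    ofHom φ x = ‖φ x‖ := rfl

/-- `R` viewed as a seminormed ring with seminorm `p`. -/
def Space (_p : CStarSeminorm R) : Type u := R

variable (p : CStarSeminorm R)

noncomputable instance : SeminormedRing p.Space :=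
  { p.toSeminorm.toAddGroupSeminorm.toSeminormedAddCommGroup, (inferInstance : Ring R) with
    norm_mul_le := fun x y => p.mul_le x y }

noncomputable instance : StarRing p.Space := inferInstanceAs (StarRing R)

noncomputable instance : NormedAlgebra ℂ p.Space :=
  { (inferInstance : Algebra ℂ R) with
    norm_smul_le := fun c x => (map_smul_eq_mul p.toSeminorm c x).le }

instance : NormedStarGroup p.Space where
  norm_star_le x := (p.star_eq x).le

/-- The identity map from `R` to `R` with the seminorm `p`. -/
def toSpace : R →⋆ₐ[ℂ] p.Space where
  toFun x := x
  map_one' := rfl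
  map_zero' := rfl
  map_mul' _ _ := rfl
  map_add' _ _ := rfl
  commutes' _ := rfl
  map_star' _ := rfl

/-- The identity map from `R` with the seminorm `p` to `R`. -/
def ofSpace : p.Space →⋆ₐ[ℂ] R where
  toFun x := x
  map_one' := rfl
  map_zero' := rfl
  map_mul' _ _ := rfl
  map_add' _ _ := rfl
  commutes' _ := rfl
  map_star' _ := rfl

lemma norm_toSpace (x : R) : ‖p.toSpace x‖ = p x := rfl

lemma norm_eq_ofSpace (x : p.Space) : ‖x‖ = p (p.ofSpace x) := rfl

lemma ofSpace_toSpace (x : R) : p.ofSpace (p.toSpace x) = x := rfl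

lemma toSpace_surjective : Function.Surjective p.toSpace := fun x => ⟨p.ofSpace x, rfl⟩

/-- The Hausdorff completion of a `⋆`-algebra in a `C⋆`-seminorm. -/
abbrev Completion : Type u := UniformSpace.Completion p.Space

end Basic

section CStar

open UniformSpace.Completion

variable {R : Type u} [Ring R] [StarRing R] [Algebra ℂ R] (p : CStarSeminorm R)

lemma uniformContinuous_star : UniformContinuous (star : p.Space → p.Space) :=
  (starNormedAddGroupHom (E := p.Space)).uniformContinuous

noncomputable instance : Star p.Completion := ⟨UniformSpace.Completion.map star⟩

lemma continuous_star : Continuous (star : p.Completion → p.Completion) :=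
  UniformSpace.Completion.continuous_map

lemma coe_star (x : p.Space) : star (x : p.Completion) = ((star x : p.Space) : p.Completion) :=
  UniformSpace.Completion.map_coe p.uniformContinuous_star x

instance : ContinuousStar p.Completion := ⟨p.continuous_star⟩

noncomputable instance : StarRing p.Completion where
  star_involutive x := by
    induction x using UniformSpace.Completion.induction_on with
    | hp => exact isClosed_eq (by fun_prop) (by fun_prop)
    | ih x => simp [coe_star]
  star_mul x y := by
    induction x, y using UniformSpace.Completion.induction_on₂ with
    | hp => exact isClosed_eq (by fun_prop) (by fun_prop)
    | ih x y => simp only [coe_star, ← coe_mul, star_mul]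
  star_add x y := by
    induction x, y using UniformSpace.Completion.induction_on₂ with
    | hp => exact isClosed_eq (by fun_prop) (by fun_prop)
    | ih x y => simp only [coe_star, ← UniformSpace.Completion.coe_add, star_add]

section Instance

variable [StarModule ℂ R]

instance : StarModule ℂ p.Space := inferInstanceAs (StarModule ℂ R)

instance : StarModule ℂ p.Completion where
  star_smul c x := by
    induction x using UniformSpace.Completion.induction_on with
    | hp =>
      exact isClosed_eq (p.continuous_star.comp (continuous_const_smul c))
        (p.continuous_star.const_smul (star c))
    | ih x =>
      rw [← UniformSpace.Completion.coe_smul, coe_star, coe_star, star_smul,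
        UniformSpace.Completion.coe_smul]

instance : CStarRing p.Completion where
  norm_mul_self_le x := by
    induction x using UniformSpace.Completion.induction_on with
    | hp => exact isClosed_le (by fun_prop) (by fun_prop)
    | ih x =>
      rw [coe_star, ← coe_mul, norm_coe, norm_coe]
      exact p.mul_self_le x

noncomputable instance : NormedAlgebra ℂ p.Completion where
  norm_smul_le := norm_smul_le

/-- The completion of a `⋆`-algebra in a `C⋆`-seminorm is a `C⋆`-algebra. -/
noncomputable instance instCStarAlgebra : CStarAlgebra p.Completion where

end Instance

/-- The canonical `⋆`-homomorphism of a `⋆`-algebra into its completion. -/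
noncomputable def of : R →⋆ₐ[ℂ] p.Completion where
  toFun x := (p.toSpace x : p.Completion)
  map_one' := by rw [map_one, UniformSpace.Completion.coe_one]
  map_zero' := by rw [map_zero, UniformSpace.Completion.coe_zero]
  map_mul' x y := by rw [map_mul, coe_mul]
  map_add' x y := by rw [map_add, UniformSpace.Completion.coe_add]
  commutes' _ := rfl
  map_star' x := by rw [map_star, coe_star]

lemma of_apply (x : R) : p.of x = (p.toSpace x : p.Completion) := rfl

lemma norm_of (x : R) : ‖p.of x‖ = p x := norm_coe _

lemma denseRange_of : DenseRange p.of :=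
  denseRange_coe.comp p.toSpace_surjective.denseRange (continuous_coe _)

lemma continuous_comp_ofSpace {B : Type v} [CStarAlgebra B] (φ : R →⋆ₐ[ℂ] B)
    (h : ∀ x, ‖φ x‖ ≤ p x) : Continuous (φ.comp p.ofSpace : p.Space →+* B) :=
  AddMonoidHomClass.continuous_of_bound _ 1 fun x => by
    rw [one_mul]; exact h (p.ofSpace x)

/-- A `⋆`-homomorphism dominated by `p` extends to the completion. -/
noncomputable def lift {B : Type v} [CStarAlgebra B] (φ : R →⋆ₐ[ℂ] B) (h : ∀ x, ‖φ x‖ ≤ p x) :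
    p.Completion →⋆ₐ[ℂ] B :=
  { extensionHom (φ.comp p.ofSpace : p.Space →+* B) (p.continuous_comp_ofSpace φ h) with
    commutes' := fun c =>
      (extensionHom_coe _ (p.continuous_comp_ofSpace φ h) (algebraMap ℂ p.Space c)).trans
        (AlgHomClass.commutes (φ.comp p.ofSpace) c)
    map_star' := fun x => by
      have hcont : Continuous (extensionHom _ (p.continuous_comp_ofSpace φ h)) :=
        continuous_extension
      change extensionHom _ (p.continuous_comp_ofSpace φ h) (star x) =
        star (extensionHom _ (p.continuous_comp_ofSpace φ h) x)
      induction x using UniformSpace.Completion.induction_on with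
      | hp => exact isClosed_eq (by fun_prop) (by fun_prop)
      | ih x =>
        rw [coe_star, extensionHom_coe, extensionHom_coe]
        exact map_star (φ.comp p.ofSpace) x }

lemma lift_of {B : Type v} [CStarAlgebra B] (φ : R →⋆ₐ[ℂ] B) (h : ∀ x, ‖φ x‖ ≤ p x) (x : R) :
    p.lift φ h (p.of x) = φ x :=
  extensionHom_coe _ (p.continuous_comp_ofSpace φ h) (p.toSpace x)

end CStar

end CStarSeminorm

namespace MinTensor

open TensorProduct

section Rep

/-- The Hilbert space tensor product. -/
def HilbertTensor (H : Type v) (K : Type w) [NormedAddCommGroup H] [InnerProductSpace ℂ H]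
    [NormedAddCommGroup K] [InnerProductSpace ℂ K] : Type (max v w) :=
  UniformSpace.Completion (H ⊗[ℂ] K)

section HilbertTensorInstances

variable (H : Type v) (K : Type w) [NormedAddCommGroup H] [InnerProductSpace ℂ H]
  [NormedAddCommGroup K] [InnerProductSpace ℂ K]

noncomputable instance : NormedAddCommGroup (HilbertTensor H K) :=
  inferInstanceAs (NormedAddCommGroup (UniformSpace.Completion (H ⊗[ℂ] K)))

noncomputable instance : InnerProductSpace ℂ (HilbertTensor H K) :=
  inferInstanceAs (InnerProductSpace ℂ (UniformSpace.Completion (H ⊗[ℂ] K)))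

instance : CompleteSpace (HilbertTensor H K) :=
  inferInstanceAs (CompleteSpace (UniformSpace.Completion (H ⊗[ℂ] K)))

end HilbertTensorInstances

/-- The canonical isometric embedding of the algebraic tensor product. -/
noncomputable def toHilbert {H : Type v} {K : Type w} [NormedAddCommGroup H]
    [InnerProductSpace ℂ H] [NormedAddCommGroup K] [InnerProductSpace ℂ K] :
    H ⊗[ℂ] K →ₗᵢ[ℂ] HilbertTensor H K :=
  UniformSpace.Completion.toComplₗᵢ

lemma denseRange_toHilbert {H : Type v} {K : Type w} [NormedAddCommGroup H]
    [InnerProductSpace ℂ H] [NormedAddCommGroup K] [InnerProductSpace ℂ K] :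
    DenseRange (toHilbert : H ⊗[ℂ] K →ₗᵢ[ℂ] HilbertTensor H K) :=
  UniformSpace.Completion.denseRange_coe

variable {A B : Type u} [CStarAlgebra A] [CStarAlgebra B]
variable {H : Type v} [NormedAddCommGroup H] [InnerProductSpace ℂ H]
variable {K : Type w} [NormedAddCommGroup K] [InnerProductSpace ℂ K]

/-- The operator `S ⊗ T` on the Hilbert space tensor product. -/
noncomputable def opTensor (S : H →L[ℂ] H) (T : K →L[ℂ] K) :
    HilbertTensor H K →L[ℂ] HilbertTensor H K :=
  (mapL S T).completion

lemma opTensor_toHilbert (S : H →L[ℂ] H) (T : K →L[ℂ] K) (x : H ⊗[ℂ] K) :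
    opTensor S T (toHilbert x) = toHilbert (mapL S T x) :=
  ContinuousLinearMap.completion_apply_coe _ _

lemma opTensor_tmul (S : H →L[ℂ] H) (T : K →L[ℂ] K) (ξ : H) (η : K) :
    opTensor S T (toHilbert (ξ ⊗ₜ η)) = toHilbert (S ξ ⊗ₜ T η) :=
  opTensor_toHilbert S T _

lemma op_ext {S T : HilbertTensor H K →L[ℂ] HilbertTensor H K}
    (h : ∀ (ξ : H) (η : K), S (toHilbert (ξ ⊗ₜ η)) = T (toHilbert (ξ ⊗ₜ η))) : S = T := by
  ext x
  induction x using denseRange_toHilbert.induction_on with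
  | hp => exact isClosed_eq S.continuous T.continuous
  | ih x =>
    induction x using TensorProduct.induction_on with
    | zero => rw [map_zero, map_zero, map_zero]
    | tmul ξ η => exact h ξ η
    | add x y hx hy => rw [map_add, map_add, map_add, hx, hy]

lemma opTensor_mul (S S' : H →L[ℂ] H) (T T' : K →L[ℂ] K) :
    opTensor (S * S') (T * T') = opTensor S T * opTensor S' T' :=
  op_ext fun ξ η => by
    simp only [mul_apply_eq_comp, opTensor_tmul]

lemma opTensor_star [CompleteSpace H] [CompleteSpace K] (S : H →L[ℂ] H) (T : K →L[ℂ] K) :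
    opTensor (star S) (star T) = star (opTensor S T) := by
  refine op_ext fun ξ η => ?_
  refine ext_inner_right ℂ fun y => ?_
  rw [ContinuousLinearMap.star_eq_adjoint (opTensor S T), ContinuousLinearMap.adjoint_inner_left]
  induction y using denseRange_toHilbert.induction_on with
  | hp =>
    exact isClosed_eq (continuous_const.inner continuous_id)
      (continuous_const.inner (opTensor S T).continuous)
  | ih y =>
    induction y using TensorProduct.induction_on with
    | zero => rw [map_zero, map_zero, inner_zero_right, inner_zero_right]
    | add x y hx hy => rw [map_add, map_add, inner_add_right, inner_add_right, hx, hy]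
    | tmul ξ' η' =>
      rw [opTensor_tmul, opTensor_tmul, LinearIsometry.inner_map_map,
        LinearIsometry.inner_map_map, inner_tmul, inner_tmul,
        ContinuousLinearMap.star_eq_adjoint, ContinuousLinearMap.star_eq_adjoint,
        ContinuousLinearMap.adjoint_inner_left, ContinuousLinearMap.adjoint_inner_left]

lemma norm_opTensor_le (S : H →L[ℂ] H) (T : K →L[ℂ] K) : ‖opTensor S T‖ ≤ ‖S‖ * ‖T‖ := by
  refine ContinuousLinearMap.opNorm_le_bound _ (by positivity) fun x => ?_
  induction x using denseRange_toHilbert.induction_on with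
  | hp => exact isClosed_le (opTensor S T).continuous.norm (continuous_const.mul continuous_norm)
  | ih x =>
    rw [opTensor_toHilbert, LinearIsometry.norm_map, LinearIsometry.norm_map]
    exact ((mapL S T).le_opNorm x).trans
      (mul_le_mul_of_nonneg_right (norm_mapL_le S T) (norm_nonneg _))

/-- `S ⊗ T` is bilinear in `(S, T)`. -/
noncomputable def opTensorₗ (H : Type v) (K : Type w) [NormedAddCommGroup H]
    [InnerProductSpace ℂ H] [NormedAddCommGroup K] [InnerProductSpace ℂ K] :
    (H →L[ℂ] H) →ₗ[ℂ] (K →L[ℂ] K) →ₗ[ℂ] (HilbertTensor H K →L[ℂ] HilbertTensor H K) :=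
  LinearMap.mk₂ ℂ opTensor
    (fun S S' T => op_ext fun ξ η => by
      simp only [add_apply, opTensor_tmul, add_tmul, map_add])
    (fun c S T => op_ext fun ξ η => by
      simp only [smul_apply, opTensor_tmul, ← smul_tmul', map_smul])
    (fun S T T' => op_ext fun ξ η => by
      simp only [add_apply, opTensor_tmul, tmul_add, map_add])
    (fun c S T => op_ext fun ξ η => by
      simp only [smul_apply, opTensor_tmul, tmul_smul, map_smul])

variable [CompleteSpace H] [CompleteSpace K]

/-- The underlying linear map of `rep` below. -/
noncomputable def repₗ (π : A →⋆ₙₐ[ℂ] (H →L[ℂ] H)) (ρ : B →⋆ₙₐ[ℂ] (K →L[ℂ] K)) :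
    A ⊗[ℂ] B →ₗ[ℂ] (HilbertTensor H K →L[ℂ] HilbertTensor H K) :=
  TensorProduct.lift ((opTensorₗ H K).compl₁₂ (π : A →ₗ[ℂ] _) (ρ : B →ₗ[ℂ] _))

lemma repₗ_tmul (π : A →⋆ₙₐ[ℂ] (H →L[ℂ] H)) (ρ : B →⋆ₙₐ[ℂ] (K →L[ℂ] K)) (a : A) (b : B) :
    repₗ π ρ (a ⊗ₜ b) = opTensor (π a) (ρ b) := rfl

lemma repₗ_mul (π : A →⋆ₙₐ[ℂ] (H →L[ℂ] H)) (ρ : B →⋆ₙₐ[ℂ] (K →L[ℂ] K)) (s t : A ⊗[ℂ] B) :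
    repₗ π ρ (s * t) = repₗ π ρ s * repₗ π ρ t := by
  induction s using TensorProduct.induction_on with
  | zero => rw [zero_mul, map_zero, zero_mul]
  | add s₁ s₂ h₁ h₂ => rw [add_mul, map_add, h₁, h₂, map_add, add_mul]
  | tmul a b =>
    induction t using TensorProduct.induction_on with
    | zero => rw [mul_zero, map_zero, mul_zero]
    | add s₁ s₂ h₁ h₂ => rw [mul_add, map_add, h₁, h₂, map_add, mul_add]
    | tmul c d =>
      rw [Algebra.TensorProduct.tmul_mul_tmul, repₗ_tmul, repₗ_tmul, repₗ_tmul, map_mul π,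
        map_mul ρ, opTensor_mul]

lemma repₗ_star (π : A →⋆ₙₐ[ℂ] (H →L[ℂ] H)) (ρ : B →⋆ₙₐ[ℂ] (K →L[ℂ] K)) (t : A ⊗[ℂ] B) :
    repₗ π ρ (star t) = star (repₗ π ρ t) := by
  induction t using TensorProduct.induction_on with
  | zero => rw [star_zero, map_zero, star_zero]
  | tmul a b => rw [star_tmul, repₗ_tmul, repₗ_tmul, map_star π, map_star ρ, opTensor_star]
  | add x y hx hy => rw [star_add, map_add, map_add, star_add, hx, hy]

/-- The representation `π ⊗ ρ` of the algebraic tensor product `A ⊗ B` on the Hilbert space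
tensor product, `(π ⊗ ρ)(a ⊗ b) = π(a) ⊗ ρ(b)`. -/
noncomputable def rep (π : A →⋆ₙₐ[ℂ] (H →L[ℂ] H)) (ρ : B →⋆ₙₐ[ℂ] (K →L[ℂ] K)) :
    A ⊗[ℂ] B →⋆ₙₐ[ℂ] (HilbertTensor H K →L[ℂ] HilbertTensor H K) where
  toFun := repₗ π ρ
  map_smul' := (repₗ π ρ).map_smul
  map_zero' := (repₗ π ρ).map_zero
  map_add' := (repₗ π ρ).map_add
  map_mul' := repₗ_mul π ρ
  map_star' := repₗ_star π ρ

lemma rep_tmul (π : A →⋆ₙₐ[ℂ] (H →L[ℂ] H)) (ρ : B →⋆ₙₐ[ℂ] (K →L[ℂ] K)) (a : A) (b : B) :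
    rep π ρ (a ⊗ₜ b) = opTensor (π a) (ρ b) := rfl

end Rep

variable (A B : Type u) [CStarAlgebra A] [CStarAlgebra B]

/-- The `C⋆`-seminorms `t ↦ ‖(π ⊗ ρ)(t)‖`, for all `⋆`-representations `π` of `A` and `ρ` of `B`
on Hilbert spaces. -/
def repSeminorms : Set (CStarSeminorm (A ⊗[ℂ] B)) :=
  {p | ∃ (H K : Type u) (_ : NormedAddCommGroup H) (_ : InnerProductSpace ℂ H)
    (_ : CompleteSpace H) (_ : NormedAddCommGroup K) (_ : InnerProductSpace ℂ K)
    (_ : CompleteSpace K) (π : A →⋆ₙₐ[ℂ] (H →L[ℂ] H)) (ρ : B →⋆ₙₐ[ℂ] (K →L[ℂ] K)),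
    p = CStarSeminorm.ofHom (rep π ρ)}

lemma repSeminorms_nonempty : (repSeminorms A B).Nonempty :=
  ⟨CStarSeminorm.ofHom (rep (H := PUnit) (K := PUnit) 0 0), PUnit, PUnit, inferInstance, inferInstance,
    inferInstance, inferInstance, inferInstance, inferInstance, 0, 0, rfl⟩

lemma repSeminorms_bounded (t : A ⊗[ℂ] B) : ∃ C, ∀ p ∈ repSeminorms A B, p t ≤ C := by
  induction t using TensorProduct.induction_on with
  | zero => exact ⟨0, fun p _ => (map_zero p.toSeminorm).le⟩
  | add s t hs ht =>
    obtain ⟨C, hC⟩ := hs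
    obtain ⟨D, hD⟩ := ht
    exact ⟨C + D, fun p hp =>
      (map_add_le_add p.toSeminorm s t).trans (add_le_add (hC p hp) (hD p hp))⟩
  | tmul a b =>
    refine ⟨‖a‖ * ‖b‖, ?_⟩
    rintro _ ⟨H, K, _, _, _, _, _, _, π, ρ, rfl⟩
    rw [CStarSeminorm.ofHom_apply, rep_tmul]
    refine (norm_opTensor_le _ _).trans ?_
    gcongr
    · exact NonUnitalStarAlgHom.norm_apply_le π a
    · exact NonUnitalStarAlgHom.norm_apply_le ρ b

/-- The minimal (spatial) `C⋆`-norm on the algebraic tensor product of two `C⋆`-algebras: the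
supremum of `‖(π ⊗ ρ)(t)‖` over all pairs of `⋆`-representations on Hilbert spaces. -/
noncomputable def norm : CStarSeminorm (A ⊗[ℂ] B) :=
  CStarSeminorm.sup (repSeminorms A B) (repSeminorms_nonempty A B) (repSeminorms_bounded A B)

end MinTensor

/-- The minimal (spatial) tensor product of two unital `C⋆`-algebras. -/
abbrev MinTensor (A B : Type u) [CStarAlgebra A] [CStarAlgebra B] : Type u :=
  (MinTensor.norm A B).Completion

namespace MinTensor

variable {A B : Type u} [CStarAlgebra A] [CStarAlgebra B]

/-- The canonical map of the algebraic tensor product into the minimal tensor product. -/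
noncomputable def of : A ⊗[ℂ] B →⋆ₐ[ℂ] MinTensor A B := (MinTensor.norm A B).of

/-- The embedding `a ↦ a ⊗ 1`. -/
noncomputable def inl : A →ₐ[ℂ] MinTensor A B :=
  (of (A := A) (B := B)).toAlgHom.comp Algebra.TensorProduct.includeLeft

/-- The embedding `b ↦ 1 ⊗ b`. -/
noncomputable def inr : B →ₐ[ℂ] MinTensor A B :=
  (of (A := A) (B := B)).toAlgHom.comp Algebra.TensorProduct.includeRight

end MinTensor

/-- The free unital complex `⋆`-algebra on a set `G` of self-adjoint generators (the
complexification of the free real algebra on `G`, whose involution reverses words). -/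
abbrev FreeStarAlg (G : Type u) : Type u := ℂ ⊗[ℝ] FreeAlgebra ℝ G

namespace FreeStarAlg

variable {G : Type u}

instance : StarModule ℝ (FreeAlgebra ℝ G) where
  star_smul r x := by
    rw [Algebra.smul_def, star_mul, FreeAlgebra.star_algebraMap, star_trivial r,
      ← Algebra.commutes r (star x), Algebra.smul_def]

instance : StarModule ℂ (FreeStarAlg G) where
  star_smul c x := by
    induction x using TensorProduct.induction_on with
    | zero => rw [smul_zero, star_zero, smul_zero]
    | add x y hx hy => rw [smul_add, star_add, hx, hy, star_add, smul_add]
    | tmul a b =>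
      rw [TensorProduct.smul_tmul', TensorProduct.star_tmul, TensorProduct.star_tmul,
        TensorProduct.smul_tmul', star_smul]

/-- The generators of the free `⋆`-algebra. -/
noncomputable def gen (g : G) : FreeStarAlg G := 1 ⊗ₜ FreeAlgebra.ι ℝ g

variable {B : Type v} [CStarAlgebra B]

lemma commute_ofId (b : G → B) (c : ℂ) (x : FreeAlgebra ℝ G) :
    Commute (Algebra.ofId ℂ B c) (FreeAlgebra.lift ℝ b x) :=
  Algebra.commutes c _

/-- The underlying algebra homomorphism of `lift` below. -/
noncomputable def liftAlg (b : G → B) : FreeStarAlg G →ₐ[ℂ] B :=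
  Algebra.TensorProduct.lift (Algebra.ofId ℂ B) (FreeAlgebra.lift ℝ b) (commute_ofId b)

lemma liftAlg_tmul (b : G → B) (c : ℂ) (x : FreeAlgebra ℝ G) :
    liftAlg b (c ⊗ₜ x) = c • FreeAlgebra.lift ℝ b x := by
  rw [liftAlg, Algebra.TensorProduct.lift_tmul, Algebra.smul_def, Algebra.ofId_apply]

lemma lift_star (b : G → B) (hb : ∀ g, IsSelfAdjoint (b g)) (x : FreeAlgebra ℝ G) :
    FreeAlgebra.lift ℝ b (star x) = star (FreeAlgebra.lift ℝ b x) := by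
  induction x using FreeAlgebra.induction with
  | grade0 r =>
    rw [FreeAlgebra.star_algebraMap, AlgHom.commutes, IsScalarTower.algebraMap_apply ℝ ℂ B,
      ← algebraMap_star_comm]
    congr 1
    exact (Complex.conj_ofReal r).symm
  | grade1 g => rw [FreeAlgebra.star_ι, FreeAlgebra.lift_ι_apply, (hb g).star_eq]
  | mul x y hx hy => rw [star_mul, map_mul, hx, hy, map_mul, star_mul]
  | add x y hx hy => rw [star_add, map_add, hx, hy, map_add, star_add]

/-- The `⋆`-homomorphism determined by a family of self-adjoint elements of a `C⋆`-algebra. -/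
noncomputable def lift (b : G → B) (hb : ∀ g, IsSelfAdjoint (b g)) : FreeStarAlg G →⋆ₐ[ℂ] B :=
  { liftAlg b with
    map_star' := fun x => by
      change liftAlg b (star x) = star (liftAlg b x)
      induction x using TensorProduct.induction_on with
      | zero => rw [star_zero, map_zero, star_zero]
      | add x y hx hy => rw [star_add, map_add, hx, hy, map_add, star_add]
      | tmul c x =>
        rw [TensorProduct.star_tmul, liftAlg_tmul, liftAlg_tmul, lift_star b hb, star_smul] }

lemma lift_tmul (b : G → B) (hb : ∀ g, IsSelfAdjoint (b g)) (c : ℂ) (x : FreeAlgebra ℝ G) :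
    lift b hb (c ⊗ₜ x) = c • FreeAlgebra.lift ℝ b x := liftAlg_tmul b c x

lemma lift_gen (b : G → B) (hb : ∀ g, IsSelfAdjoint (b g)) (g : G) :
    lift b hb (gen g) = b g := by
  rw [gen, lift_tmul, one_smul, FreeAlgebra.lift_ι_apply]

lemma lift_bounded (x : FreeStarAlg G) : ∃ C : ℝ, ∀ (B : Type v) [CStarAlgebra B] (b : G → B)
    (hb : ∀ g, IsSelfAdjoint (b g)), (∀ g, ‖b g‖ ≤ 1) → ‖lift b hb x‖ ≤ C := by
  induction x using TensorProduct.induction_on with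
  | zero => exact ⟨0, fun B _ b hb _ => by rw [map_zero, norm_zero]⟩
  | add x y hx hy =>
    obtain ⟨C, hC⟩ := hx
    obtain ⟨D, hD⟩ := hy
    exact ⟨C + D, fun B _ b hb h1 => by
      rw [map_add]; exact (norm_add_le _ _).trans (add_le_add (hC B b hb h1) (hD B b hb h1))⟩
  | tmul c x =>
    have key : ∃ C : ℝ, 0 ≤ C ∧ ∀ (B : Type v) [CStarAlgebra B] (b : G → B),
        (∀ g, ‖b g‖ ≤ 1) → ‖FreeAlgebra.lift ℝ b x‖ ≤ C := by
      induction x using FreeAlgebra.induction with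
      | grade0 r =>
        refine ⟨|r|, abs_nonneg r, fun B _ b h1 => ?_⟩
        rw [AlgHom.commutes, Algebra.algebraMap_eq_smul_one, norm_smul, Real.norm_eq_abs]
        exact mul_le_of_le_one_right (abs_nonneg r) (by
          rcases subsingleton_or_nontrivial B with h | h
          · rw [Subsingleton.elim (1 : B) 0, norm_zero]; exact zero_le_one
          · exact CStarRing.norm_one.le)
      | grade1 g =>
        exact ⟨1, zero_le_one, fun B _ b h1 => by rw [FreeAlgebra.lift_ι_apply]; exact h1 g⟩
      | mul x y hx hy =>
        obtain ⟨C, hC0, hC⟩ := hx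
        obtain ⟨D, hD0, hD⟩ := hy
        exact ⟨C * D, mul_nonneg hC0 hD0, fun B _ b h1 => by
          rw [map_mul]
          exact (norm_mul_le _ _).trans
            (mul_le_mul (hC B b h1) (hD B b h1) (norm_nonneg _) hC0)⟩
      | add x y hx hy =>
        obtain ⟨C, hC0, hC⟩ := hx
        obtain ⟨D, hD0, hD⟩ := hy
        exact ⟨C + D, add_nonneg hC0 hD0, fun B _ b h1 => by
          rw [map_add]
          exact (norm_add_le _ _).trans (add_le_add (hC B b h1) (hD B b h1))⟩
    obtain ⟨C, -, hC⟩ := key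
    exact ⟨‖c‖ * C, fun B _ b hb h1 => by
      rw [lift_tmul, norm_smul]
      exact mul_le_mul_of_nonneg_left (hC B b h1) (norm_nonneg c)⟩

end FreeStarAlg

/-- Words of length `n` in the alphabet `X`: the `n`-th level of the rooted tree `X^*`. -/
abbrev Word (X : Type u) (n : ℕ) : Type u := Fin n → X

/-- The word `ux`. -/
abbrev Word.snoc {X : Type u} {n : ℕ} (u : Word X n) (x : X) : Word X (n + 1) :=
  Fin.snoc (α := fun _ => X) u x

/-- The word `xu`. -/
abbrev Word.cons {X : Type u} {n : ℕ} (x : X) (u : Word X n) : Word X (n + 1) :=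
  Fin.cons (α := fun _ => X) x u

lemma Word.cons_snoc {X : Type u} {n : ℕ} (x : X) (u : Word X n) (y : X) :
    Word.cons x (Word.snoc u y) = Word.snoc (Word.cons x u) y :=
  Fin.cons_snoc_eq_snoc_cons x u y

/-- The defining relations of the quantum automorphism group of the rooted tree `X^*`, for a
family `a_{u,v}` indexed by pairs of words of the same length. -/
structure IsTreeFamily {X : Type u} [Fintype X] {B : Type v} [Ring B] [StarRing B]
    (a : ∀ n, Word X n → Word X n → B) : Prop where
  empty : ∀ u v : Word X 0, a 0 u v = 1
  proj : ∀ n (u v : Word X n), IsStarProjection (a n u v)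
  sum_right : ∀ n (u v : Word X n) (x : X), a n u v = ∑ y, a (n + 1) (u.snoc x) (v.snoc y)
  sum_left : ∀ n (u v : Word X n) (x : X), a n u v = ∑ z, a (n + 1) (u.snoc z) (v.snoc x)

namespace TreeAlg

variable (X : Type u) [Fintype X]

/-- The index set of the generators `a_{u,v}`. -/
abbrev Gen : Type u := Σ n : ℕ, Word X n × Word X n

variable {X}

lemma isSelfAdjoint_of_family {B : Type v} [CStarAlgebra B] {a : ∀ n, Word X n → Word X n → B}
    (ha : IsTreeFamily a) (g : Gen X) : IsSelfAdjoint (a g.1 g.2.1 g.2.2) :=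
  (ha.proj _ _ _).isSelfAdjoint

/-- The `⋆`-homomorphism on the free `⋆`-algebra given by a family satisfying the relations. -/
noncomputable def eval {B : Type v} [CStarAlgebra B] (a : ∀ n, Word X n → Word X n → B)
    (ha : IsTreeFamily a) : FreeStarAlg (Gen X) →⋆ₐ[ℂ] B :=
  FreeStarAlg.lift (fun g : Gen X => a g.1 g.2.1 g.2.2) (isSelfAdjoint_of_family ha)

lemma eval_gen {B : Type v} [CStarAlgebra B] (a : ∀ n, Word X n → Word X n → B)
    (ha : IsTreeFamily a) (n : ℕ) (u v : Word X n) :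
    eval a ha (FreeStarAlg.gen ⟨n, u, v⟩) = a n u v :=
  FreeStarAlg.lift_gen _ _ _

lemma norm_le_one {B : Type v} [CStarAlgebra B] {a : ∀ n, Word X n → Word X n → B}
    (ha : IsTreeFamily a) (g : Gen X) : ‖a g.1 g.2.1 g.2.2‖ ≤ 1 :=
  (ha.proj _ _ _).norm_le

lemma isTreeFamily_delta [DecidableEq X] {B : Type v} [Ring B] [StarRing B] :
    IsTreeFamily (fun n (u v : Word X n) => if u = v then (1 : B) else 0) where
  empty u v := if_pos (Subsingleton.elim u v)
  proj n u v := by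
    split_ifs
    · exact .one B
    · exact .zero B
  sum_right n u v x := by
    have : ∀ y, (if u.snoc x = v.snoc y then (1 : B) else 0) =
        if x = y then (if u = v then (1 : B) else 0) else 0 := fun y => by
      simp only [Word.snoc, Fin.snoc_inj]
      split_ifs <;> simp_all
    simp only [this, Finset.sum_ite_eq, Finset.mem_univ, if_true]
  sum_left n u v x := by
    have : ∀ y, (if u.snoc y = v.snoc x then (1 : B) else 0) =
        if y = x then (if u = v then (1 : B) else 0) else 0 := fun y => by
      simp only [Word.snoc, Fin.snoc_inj]
      split_ifs <;> simp_all
    simp only [this, Finset.sum_ite_eq', Finset.mem_univ, if_true]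

variable (X)

/-- The `C⋆`-seminorms on the free `⋆`-algebra that come from families satisfying the relations
in arbitrary `C⋆`-algebras. -/
def seminorms : Set (CStarSeminorm (FreeStarAlg (Gen X))) :=
  {p | ∃ (B : Type u) (_ : CStarAlgebra B) (a : ∀ n, Word X n → Word X n → B)
    (ha : IsTreeFamily a),
    p = CStarSeminorm.ofHom (B := B) (eval a ha : FreeStarAlg (Gen X) →⋆ₙₐ[ℂ] B)}

open Classical in
lemma seminorms_nonempty : (seminorms X).Nonempty :=
  ⟨_, PUnit.{u + 1} →L[ℂ] PUnit.{u + 1}, inferInstance, _, isTreeFamily_delta, rfl⟩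

lemma seminorms_bounded (x : FreeStarAlg (Gen X)) : ∃ C, ∀ p ∈ seminorms X, p x ≤ C := by
  obtain ⟨C, hC⟩ := FreeStarAlg.lift_bounded x
  refine ⟨C, ?_⟩
  rintro _ ⟨B, _, a, ha, rfl⟩
  exact hC B _ (isSelfAdjoint_of_family ha) (norm_le_one ha)

/-- The universal `C⋆`-seminorm for the relations: `‖t‖` is the supremum of `‖t(a)‖` over all
families `a` satisfying the relations in a `C⋆`-algebra. -/
noncomputable def norm : CStarSeminorm (FreeStarAlg (Gen X)) :=
  CStarSeminorm.sup (seminorms X) (seminorms_nonempty X) (seminorms_bounded X)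

end TreeAlg

/-- The quantum automorphism group `𝔸_X` of the rooted tree `X^*`: the universal unital
`C⋆`-algebra generated by elements `a_{u,v}`, `u, v ∈ X^n`, `n ≥ 0`, subject to the relations
`IsTreeFamily`. -/
abbrev TreeAlg (X : Type u) [Fintype X] : Type u := (TreeAlg.norm X).Completion

namespace TreeAlg

variable {X : Type u} [Fintype X]

/-- The generators `a_{u,v}` of `𝔸_X`. -/
noncomputable def a {n : ℕ} (u v : Word X n) : TreeAlg X :=
  (TreeAlg.norm X).of (FreeStarAlg.gen ⟨n, u, v⟩)

/-- Two elements of the free `⋆`-algebra that agree in every family satisfying the relations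
agree in `𝔸_X`. -/
lemma of_eq_of {x y : FreeStarAlg (Gen X)}
    (h : ∀ (B : Type u) [CStarAlgebra B] (a : ∀ n, Word X n → Word X n → B)
      (ha : IsTreeFamily a), eval a ha x = eval a ha y) :
    (TreeAlg.norm X).of x = (TreeAlg.norm X).of y := by
  rw [← sub_eq_zero, ← map_sub, ← norm_eq_zero, CStarSeminorm.norm_of]
  refine le_antisymm ?_ ((TreeAlg.norm X).nonneg _)
  rw [TreeAlg.norm, CStarSeminorm.sup_apply]
  refine Real.iSup_nonpos ?_
  rintro ⟨_, B, _, a, ha, rfl⟩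
  change ‖eval a ha (x - y)‖ ≤ 0
  rw [map_sub, h B a ha, sub_self, norm_zero]

/-- The generators of `𝔸_X` satisfy the defining relations. -/
lemma isTreeFamily_a : IsTreeFamily (fun n (u v : Word X n) => a u v) where
  empty u v := by
    rw [a, ← map_one (TreeAlg.norm X).of]
    exact of_eq_of fun B _ b hb => by rw [eval_gen, map_one, hb.empty]
  proj n u v := by
    refine ⟨?_, ?_⟩
    · change a u v * a u v = a u v
      rw [a, ← map_mul]
      exact of_eq_of fun B _ b hb => by
        rw [map_mul, eval_gen]; exact (hb.proj n u v).isIdempotentElem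
    · change star (a u v) = a u v
      rw [a, ← map_star]
      exact of_eq_of fun B _ b hb => by
        rw [map_star, eval_gen]; exact (hb.proj n u v).isSelfAdjoint
  sum_right n u v x := by
    simp only [a]
    rw [← map_sum]
    exact of_eq_of fun B _ b hb => by
      rw [map_sum, eval_gen]; simp only [eval_gen]; exact hb.sum_right n u v x
  sum_left n u v x := by
    simp only [a]
    rw [← map_sum]
    exact of_eq_of fun B _ b hb => by
      rw [map_sum, eval_gen]; simp only [eval_gen]; exact hb.sum_left n u v x

lemma norm_eval_le {B : Type u} [CStarAlgebra B] (b : ∀ n, Word X n → Word X n → B)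
    (hb : IsTreeFamily b) (x : FreeStarAlg (Gen X)) : ‖eval b hb x‖ ≤ TreeAlg.norm X x :=
  CStarSeminorm.le_sup (seminorms X) (seminorms_nonempty X) (seminorms_bounded X)
    (p := CStarSeminorm.ofHom (B := B) (eval b hb : FreeStarAlg (Gen X) →⋆ₙₐ[ℂ] B))
    ⟨B, inferInstance, b, hb, rfl⟩ x

/-- The universal property of `𝔸_X`. -/
noncomputable def lift {B : Type u} [CStarAlgebra B] (b : ∀ n, Word X n → Word X n → B)
    (hb : IsTreeFamily b) : TreeAlg X →⋆ₐ[ℂ] B :=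
  (TreeAlg.norm X).lift (eval b hb) (norm_eval_le b hb)

lemma lift_a {B : Type u} [CStarAlgebra B] (b : ∀ n, Word X n → Word X n → B)
    (hb : IsTreeFamily b) {n : ℕ} (u v : Word X n) : lift b hb (a u v) = b n u v :=
  ((TreeAlg.norm X).lift_of _ _ _).trans (eval_gen b hb n u v)

/-- Induction over the generators. -/
lemma induction {P : TreeAlg X → Prop} (hcl : IsClosed {x | P x})
    (halg : ∀ c : ℂ, P (algebraMap ℂ _ c)) (hgen : ∀ n (u v : Word X n), P (a u v))
    (hmul : ∀ x y, P x → P y → P (x * y)) (hadd : ∀ x y, P x → P y → P (x + y))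
    (x : TreeAlg X) : P x := by
  have key : ∀ y : FreeAlgebra ℝ (Gen X), P ((TreeAlg.norm X).of (1 ⊗ₜ[ℝ] y)) := fun y => by
    induction y using FreeAlgebra.induction with
    | grade0 r =>
      have h2 : (1 : ℂ) ⊗ₜ[ℝ] algebraMap ℝ (FreeAlgebra ℝ (Gen X)) r =
          algebraMap ℂ (FreeStarAlg (Gen X)) (r : ℂ) := by
        rw [Algebra.algebraMap_eq_smul_one, TensorProduct.tmul_smul, TensorProduct.smul_tmul',
          Algebra.TensorProduct.algebraMap_apply, Algebra.algebraMap_self_apply]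
        simp
      rw [h2, AlgHomClass.commutes]
      exact halg _
    | grade1 g => exact hgen g.1 g.2.1 g.2.2
    | mul x y hx hy =>
      have : (1 : ℂ) ⊗ₜ[ℝ] (x * y) = (1 ⊗ₜ[ℝ] x) * (1 ⊗ₜ[ℝ] y) := by
        rw [Algebra.TensorProduct.tmul_mul_tmul, one_mul]
      rw [this, map_mul]
      exact hmul _ _ hx hy
    | add x y hx hy =>
      rw [TensorProduct.tmul_add, map_add]
      exact hadd _ _ hx hy
  induction x using (TreeAlg.norm X).denseRange_of.induction_on with
  | hp => exact hcl
  | ih x =>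
    induction x using TensorProduct.induction_on with
    | zero => rw [map_zero, ← map_zero (algebraMap ℂ _)]; exact halg 0
    | add x y hx hy => rw [map_add]; exact hadd _ _ hx hy
    | tmul c x =>
      have h1 : c ⊗ₜ[ℝ] x = algebraMap ℂ (FreeStarAlg (Gen X)) c * (1 ⊗ₜ[ℝ] x) := by
        rw [Algebra.TensorProduct.algebraMap_apply, Algebra.TensorProduct.tmul_mul_tmul, one_mul,
          mul_one, Algebra.algebraMap_self_apply]
      rw [h1, map_mul, AlgHomClass.commutes]
      exact hmul _ _ (halg c) (key x)

end TreeAlg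

/-- Projections in a `C⋆`-algebra whose sum is a projection `q` lie under `q` and are pairwise
orthogonal. -/
lemma IsStarProjection.of_sum {A : Type u} [CStarAlgebra A] {ι : Type v} [Fintype ι]
    {p : ι → A} {q : A} (hp : ∀ i, IsStarProjection (p i)) (hq : IsStarProjection q)
    (h : ∑ i, p i = q) :
    (∀ i, p i * q = p i) ∧ ∀ i j, i ≠ j → p i * p j = 0 := by
  classical
  let _ := CStarAlgebra.spectralOrder A
  let _ := CStarAlgebra.spectralOrderedRing A
  have sq : ∀ i (x : A), star (p i * x) * (p i * x) = star x * p i * x := fun i x => by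
    rw [star_mul, (hp i).isSelfAdjoint.star_eq, mul_assoc, ← mul_assoc (p i), (hp i).isIdempotentElem,
      ← mul_assoc]
  have key : ∀ (s : Finset ι) (x : A), ∑ i ∈ s, star x * p i * x = 0 → ∀ i ∈ s, p i * x = 0 :=
    fun s x hs i hi => by
      simp only [← sq] at hs
      have := (Finset.sum_eq_zero_iff_of_nonneg fun i _ => star_mul_self_nonneg (p i * x)).1 hs i hi
      exact (CStarRing.star_mul_self_eq_zero_iff _).1 this
  have h1 : ∀ i, p i * q = p i := fun i => by
    have h0 : ∑ i, star (1 - q) * p i * (1 - q) = 0 := by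
      rw [← Finset.sum_mul, ← Finset.mul_sum, h, star_sub, star_one, hq.isSelfAdjoint.star_eq,
        mul_assoc, hq.mul_one_sub_self, mul_zero]
    have := key _ _ h0 i (Finset.mem_univ i)
    rw [mul_sub, mul_one, sub_eq_zero] at this
    exact this.symm
  refine ⟨h1, fun i j hij => ?_⟩
  have h0 : ∑ k ∈ Finset.univ.erase j, star (p j) * p k * p j = 0 := by
    have h2 : ∑ k, star (p j) * p k * p j = p j := by
      rw [← Finset.sum_mul, ← Finset.mul_sum, h, (hp j).isSelfAdjoint.star_eq, h1,
        (hp j).isIdempotentElem]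
    rw [← Finset.add_sum_erase _ _ (Finset.mem_univ j), (hp j).isSelfAdjoint.star_eq,
      (hp j).isIdempotentElem, (hp j).isIdempotentElem] at h2
    rw [(hp j).isSelfAdjoint.star_eq]
    exact add_eq_left.1 h2
  exact key _ _ h0 i (Finset.mem_erase.2 ⟨hij, Finset.mem_univ i⟩)

lemma Word.sum_snoc {X : Type u} [Fintype X] {M : Type v} [AddCommMonoid M] {n : ℕ}
    (f : Word X (n + 1) → M) : ∑ w, f w = ∑ w : Word X n, ∑ x, f (w.snoc x) := by
  rw [← Fintype.sum_prod_type', ← (Fin.snocEquiv fun _ : Fin (n + 1) => X).sum_comp,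
    ← (Equiv.prodComm _ _).sum_comp]
  rfl

namespace TreeAlg

variable {X : Type u} [Fintype X]

lemma sum_right {n : ℕ} (u v : Word X n) (x : X) :
    ∑ y, a (u.snoc x) (v.snoc y) = a u v := (isTreeFamily_a.sum_right n u v x).symm

lemma sum_left {n : ℕ} (u v : Word X n) (x : X) :
    ∑ z, a (u.snoc z) (v.snoc x) = a u v := (isTreeFamily_a.sum_left n u v x).symm

lemma proj {n : ℕ} (u v : Word X n) : IsStarProjection (a u v) := isTreeFamily_a.proj n u v

lemma sum_row {n : ℕ} (u : Word X n) : ∑ v, a u v = 1 := by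
  induction n with
  | zero => rw [Fintype.sum_subsingleton _ u]; exact isTreeFamily_a.empty u u
  | succ n ih =>
    rw [Word.sum_snoc, ← ih (Fin.init u)]
    refine Finset.sum_congr rfl fun w _ => ?_
    rw [← sum_right (Fin.init u) w (u (Fin.last n)), Word.snoc, Fin.snoc_init_self]

lemma sum_col {n : ℕ} (v : Word X n) : ∑ u, a u v = 1 := by
  induction n with
  | zero => rw [Fintype.sum_subsingleton _ v]; exact isTreeFamily_a.empty v v
  | succ n ih =>
    rw [Word.sum_snoc, ← ih (Fin.init v)]
    refine Finset.sum_congr rfl fun w _ => ?_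
    rw [← sum_left w (Fin.init v) (v (Fin.last n))]
    simp only [Word.snoc, Fin.snoc_init_self]

lemma row_orthogonal {n : ℕ} (u : Word X n) {v w : Word X n} (h : v ≠ w) : a u v * a u w = 0 :=
  (IsStarProjection.of_sum (fun v => proj u v) (.one _) (sum_row u)).2 v w h

lemma col_orthogonal {n : ℕ} (v : Word X n) {u w : Word X n} (h : u ≠ w) : a u v * a w v = 0 :=
  (IsStarProjection.of_sum (fun u => proj u v) (.one _) (sum_col v)).2 u w h

/-! ### The comultiplication -/

/-- `∑_w a_{u,w} ⊗ a_{w,v}` in the algebraic tensor product. -/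
noncomputable def comulGen {n : ℕ} (u v : Word X n) : TreeAlg X ⊗[ℂ] TreeAlg X :=
  ∑ w, a u w ⊗ₜ a w v

lemma isTreeFamily_comulGen : IsTreeFamily fun n (u v : Word X n) => MinTensor.of (comulGen u v) where
  empty u v := by
    rw [comulGen, Fintype.sum_subsingleton _ u, isTreeFamily_a.empty, isTreeFamily_a.empty,
      ← Algebra.TensorProduct.one_def, map_one]
  proj n u v := by
    refine IsStarProjection.map (f := MinTensor.of) ⟨?_, ?_⟩
    · change comulGen u v * comulGen u v = comulGen u v
      rw [comulGen, Finset.sum_mul]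
      refine Finset.sum_congr rfl fun w _ => ?_
      rw [Finset.mul_sum, Finset.sum_eq_single w]
      · rw [Algebra.TensorProduct.tmul_mul_tmul, (proj u w).isIdempotentElem,
          (proj w v).isIdempotentElem]
      · intro w' _ hw'
        rw [Algebra.TensorProduct.tmul_mul_tmul, row_orthogonal u hw'.symm, TensorProduct.zero_tmul]
      · intro hw
        exact absurd (Finset.mem_univ w) hw
    · change star (comulGen u v) = comulGen u v
      rw [comulGen, star_sum]
      refine Finset.sum_congr rfl fun w _ => ?_
      rw [TensorProduct.star_tmul, (proj u w).isSelfAdjoint.star_eq,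
        (proj w v).isSelfAdjoint.star_eq]
  sum_right n u v x := by
    rw [← map_sum]
    congr 1
    simp only [comulGen]
    rw [Finset.sum_comm, Word.sum_snoc]
    refine Finset.sum_congr rfl fun w _ => ?_
    simp only [← TensorProduct.tmul_sum, sum_right]
    rw [← TensorProduct.sum_tmul, sum_right]
  sum_left n u v x := by
    rw [← map_sum]
    congr 1
    simp only [comulGen]
    rw [Finset.sum_comm, Word.sum_snoc]
    refine Finset.sum_congr rfl fun w _ => ?_
    simp only [← TensorProduct.sum_tmul, sum_left]
    rw [← TensorProduct.tmul_sum, sum_left]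

/-- The comultiplication `Δ(a_{u,v}) = ∑_w a_{u,w} ⊗ a_{w,v}` of `𝔸_X`. -/
noncomputable def comul (X : Type u) [Fintype X] : TreeAlg X →⋆ₐ[ℂ] MinTensor (TreeAlg X) (TreeAlg X) :=
  lift _ isTreeFamily_comulGen

lemma comul_a {n : ℕ} (u v : Word X n) :
    comul X (a u v) = MinTensor.of (∑ w, a u w ⊗ₜ a w v) :=
  lift_a _ _ u v

/-! ### The self-similarity homomorphism -/

/-- `a_{x,y}` for letters `x, y`. -/
noncomputable def letter (x y : X) : TreeAlg X := a (fun _ : Fin 1 => x) (fun _ : Fin 1 => y)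

lemma Word.cons_zero {X : Type u} (x : X) (u : Word X 0) : u.cons x = fun _ : Fin 1 => x := by
  funext i
  rw [Fin.fin_one_eq_zero i]
  rfl

lemma _root_.Word.snoc_zero {X : Type u} (x : X) (u : Word X 0) : u.snoc x = fun _ : Fin 1 => x := by
  funext i
  rw [Fin.fin_one_eq_zero i]
  rfl

lemma cons_cons_zero (x y : X) (u v : Word X 0) : a (u.cons x) (v.cons y) = letter x y := by
  rw [Word.cons_zero, Word.cons_zero, letter]

lemma letter_proj (x y : X) : IsStarProjection (letter x y) := proj _ _

lemma sum_letter_left (y : X) : ∑ x, letter x y = 1 := by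
  have h := sum_left (Fin.elim0 : Word X 0) Fin.elim0 y
  simp only [Word.snoc_zero] at h
  rw [isTreeFamily_a.empty] at h
  exact h

lemma letter_col_orthogonal (y : X) {x x' : X} (h : x ≠ x') : letter x y * letter x' y = 0 :=
  col_orthogonal _ fun h' => h (congrFun h' 0)

/-- `a_{xu,yv} ≤ a_{x,y}`. -/
lemma cons_mul_letter (x y : X) {n : ℕ} (u v : Word X n) :
    a (u.cons x) (v.cons y) * letter x y = a (u.cons x) (v.cons y) := by
  induction n with
  | zero => rw [cons_cons_zero, (letter_proj x y).isIdempotentElem]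
  | succ n ih =>
    obtain ⟨u, s, rfl⟩ : ∃ (u' : Word X n) (s : X), u = u'.snoc s :=
      ⟨Fin.init u, u (Fin.last n), (Fin.snoc_init_self u).symm⟩
    obtain ⟨v, t, rfl⟩ : ∃ (v' : Word X n) (t : X), v = v'.snoc t :=
      ⟨Fin.init v, v (Fin.last n), (Fin.snoc_init_self v).symm⟩
    have h := (IsStarProjection.of_sum (fun t => proj ((u.cons x).snoc s) ((v.cons y).snoc t))
      (proj _ _) (sum_right (u.cons x) (v.cons y) s)).1 t
    rw [Word.cons_snoc, Word.cons_snoc, ← h, mul_assoc, ih]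

lemma letter_mul_cons (x y : X) {n : ℕ} (u v : Word X n) :
    letter x y * a (u.cons x) (v.cons y) = a (u.cons x) (v.cons y) := by
  have h := congrArg star (cons_mul_letter x y u v)
  rwa [star_mul, (letter_proj x y).isSelfAdjoint.star_eq,
    (proj (u.cons x) (v.cons y)).isSelfAdjoint.star_eq] at h

/-- The family `a_{xu,yv} + δ_{u,v} (1 - a_{x,y})`. -/
noncomputable def shiftGen [DecidableEq X] (x y : X) {n : ℕ} (u v : Word X n) : TreeAlg X :=
  a (u.cons x) (v.cons y) + (if u = v then 1 else 0) * (1 - letter x y)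

lemma shiftGen_mul_letter [DecidableEq X] (x y : X) {n : ℕ} (u v : Word X n) :
    shiftGen x y u v * letter x y = a (u.cons x) (v.cons y) := by
  rw [shiftGen, add_mul, cons_mul_letter, mul_assoc, (letter_proj x y).one_sub_mul_self, mul_zero,
    add_zero]

lemma letter_mul_shiftGen [DecidableEq X] (x y : X) {n : ℕ} (u v : Word X n) :
    letter x y * shiftGen x y u v = a (u.cons x) (v.cons y) := by
  rw [shiftGen, mul_add, letter_mul_cons]
  split_ifs
  · rw [one_mul, (letter_proj x y).mul_one_sub_self, add_zero]
  · rw [zero_mul, mul_zero, add_zero]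

lemma isTreeFamily_shiftGen [DecidableEq X] (x y : X) :
    IsTreeFamily fun n (u v : Word X n) => shiftGen x y u v where
  empty u v := by
    rw [shiftGen, cons_cons_zero, if_pos (Subsingleton.elim u v), one_mul, add_sub_cancel]
  proj n u v := by
    have h1 := proj (u.cons x) (v.cons y)
    rw [shiftGen]
    refine h1.add ?_ ?_
    · split_ifs
      · rw [one_mul]; exact (letter_proj x y).one_sub
      · rw [zero_mul]; exact .zero _
    · split_ifs
      · rw [one_mul, mul_sub, mul_one, cons_mul_letter, sub_self]
      · rw [zero_mul, mul_zero]
  sum_right n u v z := by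
    simp only [shiftGen]
    rw [Finset.sum_add_distrib, ← Finset.sum_mul]
    simp only [Word.cons_snoc]
    rw [sum_right, ← isTreeFamily_delta.sum_right n u v z]
  sum_left n u v z := by
    simp only [shiftGen]
    rw [Finset.sum_add_distrib, ← Finset.sum_mul]
    simp only [Word.cons_snoc]
    rw [sum_left, ← isTreeFamily_delta.sum_left n u v z]

/-- The unital `⋆`-endomorphism of `𝔸_X` with `a_{u,v} ↦ a_{xu,yv} + δ_{u,v} (1 - a_{x,y})`. -/
noncomputable def shift [DecidableEq X] (x y : X) : TreeAlg X →⋆ₐ[ℂ] TreeAlg X :=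
  lift _ (isTreeFamily_shiftGen x y)

lemma shift_a [DecidableEq X] (x y : X) {n : ℕ} (u v : Word X n) :
    shift x y (a u v) = shiftGen x y u v := lift_a _ _ u v

lemma continuous_shift [DecidableEq X] (x y : X) : Continuous (shift x y : TreeAlg X → TreeAlg X) :=
  AddMonoidHomClass.continuous_of_bound (shift x y) 1 fun b => by
    rw [one_mul]; exact NonUnitalStarAlgHom.norm_apply_le (shift x y) b

lemma shift_commute [DecidableEq X] (x y : X) (b : TreeAlg X) :
    shift x y b * letter x y = letter x y * shift x y b := by
  induction b using TreeAlg.induction with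
  | hcl =>
    exact isClosed_eq ((continuous_shift x y).mul continuous_const)
      (continuous_const.mul (continuous_shift x y))
  | halg c => rw [AlgHomClass.commutes, Algebra.commutes]
  | hgen n u v => rw [shift_a, shiftGen_mul_letter, letter_mul_shiftGen]
  | hmul b c hb hc => rw [map_mul, mul_assoc, hc, ← mul_assoc, hb, mul_assoc]
  | hadd b c hb hc => rw [map_add, add_mul, hb, hc, mul_add]

/-- The `(x,y)`-component `ψ_{x,y}` of `ψ`: the `⋆`-endomorphism `a_{u,v} ↦ a_{xu,yv}` of `𝔸_X`,
which maps `1` to `a_{x,y}`. -/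
noncomputable def psiEntry [DecidableEq X] (x y : X) : TreeAlg X →⋆ₙₐ[ℂ] TreeAlg X where
  toFun b := shift x y b * letter x y
  map_smul' c b := by
    rw [map_smul]; exact smul_mul_assoc _ _ _
  map_zero' := by rw [map_zero, zero_mul]
  map_add' b c := by rw [map_add, add_mul]
  map_mul' b c := by
    rw [map_mul, mul_assoc, mul_assoc, shift_commute x y c, ← mul_assoc (letter x y),
      (letter_proj x y).isIdempotentElem.eq]
  map_star' b := by
    rw [map_star, star_mul, (letter_proj x y).isSelfAdjoint.star_eq, ← map_star, shift_commute]

lemma psiEntry_apply [DecidableEq X] (x y : X) (b : TreeAlg X) :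
    psiEntry x y b = shift x y b * letter x y := rfl

lemma psiEntry_a [DecidableEq X] (x y : X) {n : ℕ} (u v : Word X n) :
    psiEntry x y (a u v) = a (u.cons x) (v.cons y) := by
  rw [psiEntry_apply, shift_a, shiftGen_mul_letter]

lemma psiEntry_one [DecidableEq X] (x y : X) : psiEntry x y 1 = letter x y := by
  rw [psiEntry_apply, map_one, one_mul]

lemma psiEntry_mul_psiEntry [DecidableEq X] {x x' : X} (h : x ≠ x') (y : X) (b c : TreeAlg X) :
    psiEntry x y b * psiEntry x' y c = 0 := by
  rw [psiEntry_apply, psiEntry_apply, shift_commute x' y c, mul_assoc, ← mul_assoc (letter x y),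
    letter_col_orthogonal y h, zero_mul, mul_zero]

section Psi

variable [DecidableEq X]

/-- The coefficient of `e_y` in `ψ(f ⊗ b)`, namely `∑_x f(x) ψ_{x,y}(b)`. -/
noncomputable def psiCoeff (y : X) : (X → ℂ) →ₗ[ℂ] TreeAlg X →ₗ[ℂ] TreeAlg X :=
  ∑ x, (LinearMap.proj x : (X → ℂ) →ₗ[ℂ] ℂ).smulRight (psiEntry x y : TreeAlg X →ₗ[ℂ] TreeAlg X)

lemma psiCoeff_apply (y : X) (f : X → ℂ) (b : TreeAlg X) :
    psiCoeff y f b = ∑ x, f x • psiEntry x y b := by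
  simp [psiCoeff, LinearMap.sum_apply]

lemma psiCoeff_mul (y : X) (f g : X → ℂ) (b c : TreeAlg X) :
    psiCoeff y (f * g) (b * c) = psiCoeff y f b * psiCoeff y g c := by
  simp only [psiCoeff_apply]
  rw [Finset.sum_mul]
  refine Finset.sum_congr rfl fun x _ => ?_
  rw [Finset.mul_sum, Finset.sum_eq_single x]
  · rw [smul_mul_smul_comm, map_mul, Pi.mul_apply]
  · intro x' _ hx'
    rw [smul_mul_smul_comm, psiEntry_mul_psiEntry hx'.symm, smul_zero]
  · intro hx
    exact absurd (Finset.mem_univ x) hx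

lemma psiCoeff_one (y : X) : psiCoeff y 1 1 = 1 := by
  rw [psiCoeff_apply]
  refine (Finset.sum_congr rfl fun x _ => ?_).trans (sum_letter_left y)
  rw [psiEntry_one, Pi.one_apply, one_smul]

lemma psiCoeff_star (y : X) (f : X → ℂ) (b : TreeAlg X) :
    psiCoeff y (star f) (star b) = star (psiCoeff y f b) := by
  rw [psiCoeff_apply, psiCoeff_apply, star_sum]
  refine Finset.sum_congr rfl fun x _ => ?_
  rw [star_smul, map_star, Pi.star_apply]

/-- The underlying linear map of `psi` below. -/
noncomputable def psiₗ : (X → ℂ) ⊗[ℂ] TreeAlg X →ₗ[ℂ] TreeAlg X ⊗[ℂ] (X → ℂ) :=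
  ∑ y, ((TensorProduct.mk ℂ (TreeAlg X) (X → ℂ)).flip (Pi.single y 1)).comp
    (TensorProduct.lift (psiCoeff y))

lemma psiₗ_tmul (f : X → ℂ) (b : TreeAlg X) :
    psiₗ (f ⊗ₜ b) = ∑ y, psiCoeff y f b ⊗ₜ Pi.single y 1 := by
  simp [psiₗ, LinearMap.sum_apply]

lemma psiₗ_mul (f g : X → ℂ) (b c : TreeAlg X) :
    psiₗ ((f * g) ⊗ₜ (b * c)) = psiₗ (f ⊗ₜ b) * psiₗ (g ⊗ₜ c) := by
  simp only [psiₗ_tmul]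
  rw [Finset.sum_mul]
  refine Finset.sum_congr rfl fun y _ => ?_
  rw [Finset.mul_sum, Finset.sum_eq_single y]
  · rw [Algebra.TensorProduct.tmul_mul_tmul, psiCoeff_mul, ← Pi.single_mul, one_mul]
  · intro y' _ hy'
    have : (Pi.single y 1 : X → ℂ) * Pi.single y' 1 = 0 := by
      funext z
      rw [Pi.mul_apply, Pi.single_apply, Pi.single_apply, Pi.zero_apply]
      split_ifs <;> simp_all
    rw [Algebra.TensorProduct.tmul_mul_tmul, this, TensorProduct.tmul_zero]
  · intro hy
    exact absurd (Finset.mem_univ y) hy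

lemma psiₗ_one : psiₗ ((1 : X → ℂ) ⊗ₜ[ℂ] (1 : TreeAlg X)) = 1 := by
  rw [psiₗ_tmul, Algebra.TensorProduct.one_def]
  simp only [psiCoeff_one]
  rw [← TensorProduct.tmul_sum]
  congr 1
  exact Finset.univ_sum_single (1 : X → ℂ)

lemma psiₗ_star (t : (X → ℂ) ⊗[ℂ] TreeAlg X) : psiₗ (star t) = star (psiₗ t) := by
  induction t using TensorProduct.induction_on with
  | zero => rw [star_zero, map_zero, star_zero]
  | add s t hs ht => rw [star_add, map_add, hs, ht, map_add, star_add]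
  | tmul f b =>
    rw [TensorProduct.star_tmul, psiₗ_tmul, psiₗ_tmul, star_sum]
    refine Finset.sum_congr rfl fun y _ => ?_
    rw [psiCoeff_star, TensorProduct.star_tmul]
    congr 1
    rw [← Pi.single_star, star_one]

variable (X) in
/-- The self-similarity homomorphism `ψ : ℂ^X ⊗ 𝔸_X → 𝔸_X ⊗ ℂ^X`, the quantum analogue of
`(g, x) ↦ (g(x), g|_x)`: it is determined by `ψ(e_x ⊗ a_{u,v}) = ∑_y a_{xu,yv} ⊗ e_y`. -/
noncomputable def psi : (X → ℂ) ⊗[ℂ] TreeAlg X →⋆ₐ[ℂ] TreeAlg X ⊗[ℂ] (X → ℂ) :=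
  { Algebra.TensorProduct.algHomOfLinearMapTensorProduct psiₗ
      (fun f g b c => psiₗ_mul f g b c) psiₗ_one with
    map_star' := psiₗ_star }

lemma psi_single (x : X) (b : TreeAlg X) :
    psi X (Pi.single x 1 ⊗ₜ b) = ∑ y, psiEntry x y b ⊗ₜ Pi.single y 1 := by
  refine (psiₗ_tmul _ _).trans (Finset.sum_congr rfl fun y _ => ?_)
  rw [psiCoeff_apply, Finset.sum_eq_single x]
  · rw [Pi.single_eq_same, one_smul]
  · intro x' _ hx'
    rw [Pi.single_eq_of_ne hx', zero_smul]
  · intro hx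
    exact absurd (Finset.mem_univ x) hx

lemma psi_single_a (x : X) {n : ℕ} (u v : Word X n) :
    psi X (Pi.single x 1 ⊗ₜ a u v) = ∑ y, a (u.cons x) (v.cons y) ⊗ₜ Pi.single y 1 := by
  simp only [psi_single, psiEntry_a]

end Psi

end TreeAlg

/-! ### Finite-dimensional unitary representations -/

section Representations

variable {A : Type u} [CStarAlgebra A]
variable {H : Type v} [NormedAddCommGroup H] [InnerProductSpace ℂ H]
variable {K : Type w} [NormedAddCommGroup K] [InnerProductSpace ℂ K]

/-- `u ∈ B(H) ⊗ A` is a (finite-dimensional) unitary representation on `H`, with respect to the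
comultiplication `Δ`, if `u` is unitary and `(id ⊗ Δ)(u) = u₁₂ u₁₃` in `B(H) ⊗ (A ⊗ A)`. -/
def IsUnitaryRep [FiniteDimensional ℂ H] (Δ : A →⋆ₐ[ℂ] MinTensor A A)
    (u : Module.End ℂ H ⊗[ℂ] A) : Prop :=
  u ∈ unitary (Module.End ℂ H ⊗[ℂ] A) ∧
    Algebra.TensorProduct.map (AlgHom.id ℂ (Module.End ℂ H)) Δ.toAlgHom u =
      Algebra.TensorProduct.map (AlgHom.id ℂ (Module.End ℂ H)) MinTensor.inl u *
        Algebra.TensorProduct.map (AlgHom.id ℂ (Module.End ℂ H)) MinTensor.inr u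

/-- `T : H → K` intertwines `u ∈ B(H) ⊗ A` and `v ∈ B(K) ⊗ A` if `(T ⊗ 1) u = v (T ⊗ 1)` in
`B(H, K) ⊗ A`. -/
def IsIntertwiner (T : H →ₗ[ℂ] K) (u : Module.End ℂ H ⊗[ℂ] A) (v : Module.End ℂ K ⊗[ℂ] A) :
    Prop :=
  LinearMap.rTensor A (LinearMap.compRight ℂ T : Module.End ℂ H →ₗ[ℂ] (H →ₗ[ℂ] K)) u =
    LinearMap.rTensor A (LinearMap.lcomp ℂ K T : Module.End ℂ K →ₗ[ℂ] (H →ₗ[ℂ] K)) v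

/-- The matrix coefficient `(⟨ξ, · η⟩ ⊗ id)(u) ∈ A` of `u ∈ B(H) ⊗ A`. For an orthonormal basis
`b` of `H`, the matrix entry `u_{i,j}` is `coeff (b i) (b j) u`. -/
noncomputable def coeff (ξ η : H) : Module.End ℂ H ⊗[ℂ] A →ₗ[ℂ] A :=
  (TensorProduct.lid ℂ A).toLinearMap ∘ₗ
    LinearMap.rTensor A (innerₛₗ ℂ ξ ∘ₗ LinearMap.applyₗ η)

lemma coeff_tmul (ξ η : H) (S : Module.End ℂ H) (c : A) :
    coeff ξ η (S ⊗ₜ c) = inner ℂ ξ (S η) • c := rfl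

/-- The relation `ψ(e_x ⊗ u_{i,j}) = ∑_y w_{(x,i),(y,j)} ⊗ e_y` between the matrix entries of
`u ∈ B(H) ⊗ 𝔸_X` with respect to the orthonormal basis `b = (b_i)` of `H`, and those of
`w ∈ B(ℂ^X ⊗ H) ⊗ 𝔸_X` with respect to the orthonormal basis `(e_x ⊗ b_i)`. -/
def IsPsiOf {X : Type u} [Fintype X] [DecidableEq X] {ι : Type*} [Fintype ι]
    (b : OrthonormalBasis ι ℂ H) (u : Module.End ℂ H ⊗[ℂ] TreeAlg X)
    (w : Module.End ℂ (EuclideanSpace ℂ X ⊗[ℂ] H) ⊗[ℂ] TreeAlg X) : Prop :=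
  ∀ (x : X) (i j : ι),
    TreeAlg.psi X (Pi.single x 1 ⊗ₜ coeff (b i) (b j) u) =
      ∑ y : X, coeff (EuclideanSpace.single x (1 : ℂ) ⊗ₜ[ℂ] b i)
        (EuclideanSpace.single y (1 : ℂ) ⊗ₜ[ℂ] b j) w ⊗ₜ Pi.single y 1

end Representations

/-! Write `ψ_{x,y}` for the (in general non-unital) `⋆`-endomorphism `a_{u,v} ↦ a_{xu,yv}` of `𝔸_X`,
so that `ψ(e_x ⊗ b) = ∑_y ψ_{x,y}(b) ⊗ e_y`. The relations require exactly that the `(x,y)` block of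
`ψ(u)` be `(id ⊗ ψ_{x,y})(u)`. Hence `ψ(u)` has to be `∑_{x,y} e_{x,y} ⊗ (id ⊗ ψ_{x,y})(u)`, which
is `psiRep`. This formula involves no basis, so it serves all orthonormal bases at once. Uniqueness
follows because the `e_y` are linearly independent and matrix entries determine an element
(`IsPsiOf.eq_psiRep`).

Unitarity comes from the magic unitary `(a_{x,y})`. Since `ψ_{x,y}(1) = a_{x,y}`, ranges of
`ψ_{x,y}` in the same row or the same column multiply to zero, so that the `(x,z)` block of
`ψ(u)ψ(u)^*` is `δ_{x,z} ∑_y (id ⊗ ψ_{x,y})(uu^*) = δ_{x,z} ∑_y 1 ⊗ a_{x,y} = δ_{x,z}`; the other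
product is treated in the same way with rows in place of columns.

The representation property rests on `comul_psiEntry`: `Δ ψ_{x,y} = ∑_z (ψ_{x,z} ⊗ ψ_{z,y}) Δ`,
which on generators is the sorting of words of length `n + 1` by their first letter. Together with
matrix multiplication of blocks it carries `(id ⊗ Δ)(u) = u₁₂ u₁₃` over to `ψ(u)`
(`map_blockSum_eq_mul`). The analytic ingredient is the extension of `ψ_{x,z} ⊗ ψ_{z,y}` to the
minimal tensor product.

Intertwiners pass to `ψ` because `id ⊗ T` acts only on the factor `H` of each block, whereas
`ψ_{x,y}` acts only on `𝔸_X`. -/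

namespace MinTensor

/-! ### Tensor products of homomorphisms on the minimal tensor product. -/

variable {A B C D : Type u} [CStarAlgebra A] [CStarAlgebra B] [CStarAlgebra C] [CStarAlgebra D]

lemma norm_rep_le {H K : Type u} [NormedAddCommGroup H] [InnerProductSpace ℂ H] [CompleteSpace H]
    [NormedAddCommGroup K] [InnerProductSpace ℂ K] [CompleteSpace K]
    (π : A →⋆ₙₐ[ℂ] (H →L[ℂ] H)) (ρ : B →⋆ₙₐ[ℂ] (K →L[ℂ] K)) (t : A ⊗[ℂ] B) :
    ‖rep π ρ t‖ ≤ norm A B t :=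
  CStarSeminorm.le_sup (repSeminorms A B) (repSeminorms_nonempty A B) (repSeminorms_bounded A B)
    (p := CStarSeminorm.ofHom (rep π ρ))
    ⟨H, K, _, _, inferInstance, _, _, inferInstance, π, ρ, rfl⟩ t

/-- The algebraic tensor product of two unital `⋆`-homomorphisms. -/
noncomputable def algMap (φ : A →⋆ₐ[ℂ] C) (χ : B →⋆ₐ[ℂ] D) : A ⊗[ℂ] B →⋆ₐ[ℂ] C ⊗[ℂ] D :=
  { Algebra.TensorProduct.map φ.toAlgHom χ.toAlgHom with
    map_star' := fun t => by
      change Algebra.TensorProduct.map φ.toAlgHom χ.toAlgHom (star t) =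
        star (Algebra.TensorProduct.map φ.toAlgHom χ.toAlgHom t)
      induction t using TensorProduct.induction_on with
      | zero => rw [star_zero, map_zero, star_zero]
      | add s t hs ht => rw [star_add, map_add, hs, ht, map_add, star_add]
      | tmul a b =>
        rw [TensorProduct.star_tmul, Algebra.TensorProduct.map_tmul,
          Algebra.TensorProduct.map_tmul, TensorProduct.star_tmul]
        exact congrArg₂ (· ⊗ₜ[ℂ] ·) (map_star φ a) (map_star χ b) }

lemma algMap_tmul (φ : A →⋆ₐ[ℂ] C) (χ : B →⋆ₐ[ℂ] D) (a : A) (b : B) :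
    algMap φ χ (a ⊗ₜ b) = φ a ⊗ₜ χ b := rfl

/-- The minimal norm is contracted by tensor products of `⋆`-homomorphisms. -/
lemma norm_algMap_le (φ : A →⋆ₐ[ℂ] C) (χ : B →⋆ₐ[ℂ] D) (t : A ⊗[ℂ] B) :
    norm C D (algMap φ χ t) ≤ norm A B t := by
  rw [norm, CStarSeminorm.sup_apply]
  have := (repSeminorms_nonempty C D).to_subtype
  refine ciSup_le ?_
  rintro ⟨_, H, K, _, _, _, _, _, _, π, ρ, rfl⟩
  -- Pulling a pair of representations of `C` and `D` back along `φ` and `χ` gives a pair for `A`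
  -- and `B`, which takes part in the supremum defining the norm on `A ⊗ B`.
  have h : rep π ρ (algMap φ χ t) =
      rep (π.comp (φ : A →⋆ₙₐ[ℂ] C)) (ρ.comp (χ : B →⋆ₙₐ[ℂ] D)) t := by
    induction t using TensorProduct.induction_on with
    | zero => simp only [map_zero]
    | add s t hs ht => simp only [map_add, hs, ht]
    | tmul a b => rfl
  rw [CStarSeminorm.ofHom_apply, h]
  exact norm_rep_le _ _ t

/-- The tensor product of two unital `⋆`-homomorphisms on the minimal tensor product. -/
noncomputable def map (φ : A →⋆ₐ[ℂ] C) (χ : B →⋆ₐ[ℂ] D) : MinTensor A B →⋆ₐ[ℂ] MinTensor C D :=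
  (norm A B).lift ((of (A := C) (B := D)).comp (algMap φ χ)) fun t =>
    ((norm C D).norm_of (algMap φ χ t)).le.trans (norm_algMap_le φ χ t)

lemma map_of (φ : A →⋆ₐ[ℂ] C) (χ : B →⋆ₐ[ℂ] D) (t : A ⊗[ℂ] B) :
    map φ χ (of t) = of (algMap φ χ t) :=
  (norm A B).lift_of _ _ t

lemma continuous_map (φ : A →⋆ₐ[ℂ] C) (χ : B →⋆ₐ[ℂ] D) :
    Continuous (map φ χ : MinTensor A B → MinTensor C D) :=
  AddMonoidHomClass.continuous_of_bound (map φ χ) 1 fun b => by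
    rw [one_mul]; exact NonUnitalStarAlgHom.norm_apply_le (map φ χ) b

lemma of_tmul_mul_of_tmul (a a' : A) (b b' : B) :
    of (a ⊗ₜ[ℂ] b) * of (a' ⊗ₜ[ℂ] b') = of ((a * a') ⊗ₜ[ℂ] (b * b')) := by
  rw [← map_mul, Algebra.TensorProduct.tmul_mul_tmul]

/-- Identifies the products of entries that occur in `u₁₂ u₁₃` with elementary tensors. -/
lemma inl_mul_inr (a : A) (b : B) : inl a * inr b = of (a ⊗ₜ[ℂ] b) := by
  change of (a ⊗ₜ[ℂ] (1 : B)) * of ((1 : A) ⊗ₜ[ℂ] b) = _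
  rw [of_tmul_mul_of_tmul, mul_one, one_mul]

/-- The map `t ↦ (φ ⊗ χ)(t) (p ⊗ q)` on the minimal tensor product. -/
noncomputable def mapMul (φ : A →⋆ₐ[ℂ] C) (χ : B →⋆ₐ[ℂ] D) (p : C) (q : D) :
    MinTensor A B →ₗ[ℂ] MinTensor C D :=
  LinearMap.mulRight ℂ (of (p ⊗ₜ[ℂ] q)) ∘ₗ (map φ χ).toAlgHom.toLinearMap

section MapMul

variable (φ : A →⋆ₐ[ℂ] C) (χ : B →⋆ₐ[ℂ] D) {p : C} {q : D}

lemma mapMul_apply (t : MinTensor A B) : mapMul φ χ p q t = map φ χ t * of (p ⊗ₜ[ℂ] q) := rfl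

lemma continuous_mapMul : Continuous (mapMul φ χ p q) :=
  (continuous_map φ χ).mul continuous_const

/-- Thus `mapMul` extends the tensor product of `a ↦ φ(a) p` and `b ↦ χ(b) q`. The non-unital
`ψ_{x,y}` has this form, with a unital `⋆`-homomorphism and a projection commuting with its range,
so extending unital homomorphisms suffices. -/
lemma mapMul_of_tmul (a : A) (b : B) :
    mapMul φ χ p q (of (a ⊗ₜ[ℂ] b)) = of ((φ a * p) ⊗ₜ[ℂ] (χ b * q)) := by
  rw [mapMul_apply, map_of, algMap_tmul, of_tmul_mul_of_tmul]

/-- Clear on elementary tensors; the general case follows by density, both sides being continuous in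
`t`. -/
lemma map_mul_of_commute (hp : ∀ a, φ a * p = p * φ a) (hq : ∀ b, χ b * q = q * χ b)
    (t : MinTensor A B) : map φ χ t * of (p ⊗ₜ[ℂ] q) = of (p ⊗ₜ[ℂ] q) * map φ χ t := by
  induction t using (norm A B).denseRange_of.induction_on with
  | hp =>
    exact isClosed_eq ((continuous_map φ χ).mul continuous_const)
      (continuous_const.mul (continuous_map φ χ))
  | ih t =>
    change map φ χ (of t) * _ = _ * map φ χ (of t)
    rw [map_of, ← map_mul, ← map_mul]
    congr 1
    induction t using TensorProduct.induction_on with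
    | zero => rw [map_zero, zero_mul, mul_zero]
    | add s t hs ht => rw [map_add, add_mul, hs, ht, mul_add]
    | tmul b c =>
      rw [algMap_tmul, Algebra.TensorProduct.tmul_mul_tmul, Algebra.TensorProduct.tmul_mul_tmul,
        hp, hq]

/-- The cut-down `t ↦ (φ ⊗ χ)(t) P` by an idempotent `P = p ⊗ q` commuting with the range is
multiplicative. -/
lemma mapMul_mul (hp : ∀ a, φ a * p = p * φ a) (hq : ∀ b, χ b * q = q * χ b)
    (hp' : p * p = p) (hq' : q * q = q) (s t : MinTensor A B) :
    mapMul φ χ p q (s * t) = mapMul φ χ p q s * mapMul φ χ p q t := by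
  rw [mapMul_apply, mapMul_apply, mapMul_apply, map_mul, map_mul_of_commute φ χ hp hq t,
    mul_assoc, map_mul_of_commute φ χ hp hq t, mul_assoc, ← mul_assoc (of _) (of _),
    of_tmul_mul_of_tmul, hp', hq']

/-- After `p' ⊗ q'` is commuted past the image of `t`, the product `(p ⊗ q)(p' ⊗ q')` stands in the
middle; orthogonality in the first leg alone makes it vanish. -/
lemma mapMul_mul_mapMul_eq_zero (φ' : A →⋆ₐ[ℂ] C) (χ' : B →⋆ₐ[ℂ] D) {p' : C} {q' : D}
    (hp : ∀ a, φ' a * p' = p' * φ' a) (hq : ∀ b, χ' b * q' = q' * χ' b) (h : p * p' = 0)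
    (s t : MinTensor A B) : mapMul φ χ p q s * mapMul φ' χ' p' q' t = 0 := by
  rw [mapMul_apply, mapMul_apply, map_mul_of_commute φ' χ' hp hq t, mul_assoc,
    ← mul_assoc (of _) (of _), of_tmul_mul_of_tmul, h, TensorProduct.zero_tmul, map_zero,
    zero_mul, mul_zero]

end MapMul

end MinTensor

/-! ### Compatibility of the comultiplication with the entries of the self-similarity. -/

namespace TreeAlg

variable {X : Type u} [Fintype X]

lemma sum_letter_right (x : X) : ∑ y, letter x y = 1 := by
  have h := sum_right (Fin.elim0 : Word X 0) Fin.elim0 x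
  simp only [Word.snoc_zero] at h
  rw [isTreeFamily_a.empty] at h
  exact h

lemma letter_row_orthogonal (x : X) {y y' : X} (h : y ≠ y') : letter x y * letter x y' = 0 :=
  row_orthogonal _ fun h' => h (congrFun h' 0)

lemma _root_.Word.sum_cons {M : Type v} [AddCommMonoid M] {n : ℕ}
    (f : Word X (n + 1) → M) : ∑ w, f w = ∑ x, ∑ w : Word X n, f (w.cons x) := by
  rw [← Fintype.sum_prod_type', ← (Fin.consEquiv fun _ : Fin (n + 1) => X).sum_comp]
  rfl

lemma continuous_comul : Continuous (comul X) :=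
  AddMonoidHomClass.continuous_of_bound (comul X) 1 fun b => by
    rw [one_mul]; exact NonUnitalStarAlgHom.norm_apply_le (comul X) b

lemma comul_a_eq_sum {n : ℕ} (u v : Word X n) :
    comul X (a u v) = ∑ w, MinTensor.of (a u w ⊗ₜ[ℂ] a w v) := by
  rw [comul_a, map_sum]

lemma comul_letter (x y : X) :
    comul X (letter x y) = ∑ z, MinTensor.of (letter x z ⊗ₜ[ℂ] letter z y) := by
  rw [letter, comul_a_eq_sum, Word.sum_cons]
  refine Finset.sum_congr rfl fun z _ => ?_
  -- A word of length 1 is a letter followed by the empty word, so the inner sum has a single term.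
  rw [Fintype.sum_subsingleton _ (Fin.elim0 : Word X 0), Word.cons_zero]
  rfl

variable [DecidableEq X]

/-- Once `ψ_{x,y'}(c)` is written with its letter in front, `a_{x,y} a_{x,y'} = 0` stands in the
middle. This gives `ψ(u)^* ψ(u) = 1`, as the column version gives `ψ(u) ψ(u)^* = 1`. -/
lemma psiEntry_mul_psiEntry_row (x : X) {y y' : X} (h : y ≠ y') (b c : TreeAlg X) :
    psiEntry x y b * psiEntry x y' c = 0 := by
  rw [psiEntry_apply, psiEntry_apply, shift_commute x y' c, mul_assoc, ← mul_assoc (letter x y),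
    letter_row_orthogonal x h, zero_mul, mul_zero]

lemma continuous_psiEntry (x y : X) : Continuous (psiEntry x y) :=
  (continuous_shift x y).mul continuous_const

/-- The extension of `ψ_{x,z} ⊗ ψ_{z,y}` to the minimal tensor product. -/
noncomputable def psiEntryTensor (x y z : X) :
    MinTensor (TreeAlg X) (TreeAlg X) →ₗ[ℂ] MinTensor (TreeAlg X) (TreeAlg X) :=
  MinTensor.mapMul (shift x z) (shift z y) (letter x z) (letter z y)

lemma continuous_psiEntryTensor (x y z : X) : Continuous (psiEntryTensor x y z) :=
  MinTensor.continuous_mapMul _ _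

lemma psiEntryTensor_of_tmul (x y z : X) (b c : TreeAlg X) :
    psiEntryTensor x y z (MinTensor.of (b ⊗ₜ[ℂ] c)) =
      MinTensor.of (psiEntry x z b ⊗ₜ[ℂ] psiEntry z y c) :=
  MinTensor.mapMul_of_tmul _ _ b c

lemma psiEntryTensor_one (x y z : X) :
    psiEntryTensor x y z 1 = MinTensor.of (letter x z ⊗ₜ[ℂ] letter z y) := by
  rw [psiEntryTensor, MinTensor.mapMul_apply, map_one, one_mul]

lemma psiEntryTensor_mul (x y z : X) (s t : MinTensor (TreeAlg X) (TreeAlg X)) :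
    psiEntryTensor x y z (s * t) = psiEntryTensor x y z s * psiEntryTensor x y z t :=
  MinTensor.mapMul_mul _ _ (shift_commute x z) (shift_commute z y)
    (letter_proj x z).isIdempotentElem.eq (letter_proj z y).isIdempotentElem.eq s t

lemma psiEntryTensor_mul_of_ne (x y : X) {z z' : X} (h : z ≠ z')
    (s t : MinTensor (TreeAlg X) (TreeAlg X)) :
    psiEntryTensor x y z s * psiEntryTensor x y z' t = 0 :=
  MinTensor.mapMul_mul_mapMul_eq_zero _ _ _ _ (shift_commute x z') (shift_commute z' y)
    (letter_row_orthogonal x h) s t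

/-- The cross terms `z ≠ z'` vanish because `a_{x,z} a_{x,z'} = 0`. Hence `∑_z ψ_{x,z} ⊗ ψ_{z,y}` is
multiplicative, and `comul_psiEntry` can be checked on generators and scalars. -/
lemma sum_psiEntryTensor_mul (x y : X) (s t : MinTensor (TreeAlg X) (TreeAlg X)) :
    (∑ z, psiEntryTensor x y z s) * ∑ z, psiEntryTensor x y z t =
      ∑ z, psiEntryTensor x y z (s * t) := by
  rw [Finset.sum_mul]
  refine Finset.sum_congr rfl fun z _ => ?_
  rw [Finset.mul_sum, Finset.sum_eq_single z, psiEntryTensor_mul]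
  · intro z' _ hz
    exact psiEntryTensor_mul_of_ne x y hz.symm _ _
  · intro hz
    exact absurd (Finset.mem_univ z) hz

lemma psiEntryTensor_comul_a (x y z : X) {n : ℕ} (u v : Word X n) :
    psiEntryTensor x y z (comul X (a u v)) =
      ∑ w : Word X n, MinTensor.of (a (u.cons x) (w.cons z) ⊗ₜ[ℂ] a (w.cons z) (v.cons y)) :=
  (congrArg (psiEntryTensor x y z) (comul_a_eq_sum u v)).trans <|
    (map_sum (psiEntryTensor x y z) _ _).trans <| Finset.sum_congr rfl fun w _ =>
      (psiEntryTensor_of_tmul x y z (a u w) (a w v)).trans <|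
        congrArg MinTensor.of (congrArg₂ (· ⊗ₜ[ℂ] ·) (psiEntry_a x z u w) (psiEntry_a z y w v))

/-- `Δ ψ_{x,y} = ∑_z (ψ_{x,z} ⊗ ψ_{z,y}) Δ`. -/
lemma comul_psiEntry (x y : X) (b : TreeAlg X) :
    comul X (psiEntry x y b) = ∑ z, psiEntryTensor x y z (comul X b) := by
  induction b using TreeAlg.induction with
  | hcl =>
    exact isClosed_eq (continuous_comul.comp (continuous_psiEntry x y))
      (continuous_finsetSum _ fun z _ => (continuous_psiEntryTensor x y z).comp continuous_comul)
  -- `ψ_{x,y}` need not be unital, so scalars carry content: `c • 1` goes to `c • a_{x,y}`, and the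
  -- claim becomes the formula for `Δ(a_{x,y})`.
  | halg c =>
    have h1 : comul X (c • letter x y) =
        ∑ z, c • MinTensor.of (letter x z ⊗ₜ[ℂ] letter z y) :=
      (map_smul (comul X) c (letter x y)).trans
        ((congrArg (c • ·) (comul_letter x y)).trans Finset.smul_sum)
    have h2 : comul X (c • 1) = c • 1 :=
      (map_smul (comul X) c 1).trans (congrArg (c • ·) (map_one (comul X)))
    have h3 : psiEntry x y (c • 1) = c • letter x y :=
      (map_smul (psiEntry x y) c 1).trans (congrArg (c • ·) (psiEntry_one x y))
    rw [Algebra.algebraMap_eq_smul_one, h3, h1, h2]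
    exact Finset.sum_congr rfl fun z _ => ((map_smul (psiEntryTensor x y z) c 1).trans
      (congrArg (c • ·) (psiEntryTensor_one x y z))).symm
  -- The words of length `n + 1` summed over in `Δ(a_{xu,yv})` are sorted by their first letter `z`.
  | hgen n u v =>
    exact (congrArg (comul X) (psiEntry_a x y u v)).trans <|
      (comul_a_eq_sum (u.cons x) (v.cons y)).trans <| (Word.sum_cons _).trans <|
      Finset.sum_congr rfl fun z _ => (psiEntryTensor_comul_a x y z u v).symm
  | hmul b c hb hc =>
    exact (congrArg (comul X) (map_mul (psiEntry x y) b c)).trans <|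
      (map_mul (comul X) _ _).trans <| (congrArg₂ (· * ·) hb hc).trans <|
      (sum_psiEntryTensor_mul x y _ _).trans <| Finset.sum_congr rfl fun z _ =>
        congrArg (psiEntryTensor x y z) (map_mul (comul X) b c).symm
  | hadd b c hb hc =>
    exact (congrArg (comul X) (map_add (psiEntry x y) b c)).trans <|
      (map_add (comul X) _ _).trans <| (congrArg₂ (· + ·) hb hc).trans <|
      Finset.sum_add_distrib.symm.trans <| Finset.sum_congr rfl fun z _ =>
        (map_add (psiEntryTensor x y z) _ _).symm.trans <|
          congrArg (psiEntryTensor x y z) (map_add (comul X) b c).symm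

end TreeAlg

/-! ### Block matrices over `ℂ^X` with operator blocks. -/

section BlockSum

variable {X : Type u} [DecidableEq X]
variable {H : Type v} [NormedAddCommGroup H] [InnerProductSpace ℂ H]
variable {K : Type w} [NormedAddCommGroup K] [InnerProductSpace ℂ K]

/-- The matrix unit `e_{x,y}` on `ℂ^X`. -/
noncomputable def matrixUnit (x y : X) : Module.End ℂ (EuclideanSpace ℂ X) :=
  (EuclideanSpace.proj y : EuclideanSpace ℂ X →L[ℂ] ℂ).toLinearMap.smulRight
    (EuclideanSpace.single x 1)

lemma matrixUnit_apply (x y : X) (ξ : EuclideanSpace ℂ X) :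
    matrixUnit x y ξ = ξ y • EuclideanSpace.single x (1 : ℂ) := rfl

lemma matrixUnit_mul_same (x y z : X) : matrixUnit x y * matrixUnit y z = matrixUnit x z := by
  ext1 ξ
  simp [matrixUnit_apply]

lemma matrixUnit_mul_of_ne (x z : X) {y y' : X} (h : y ≠ y') :
    matrixUnit x y * matrixUnit y' z = 0 := by
  refine LinearMap.ext fun ξ => ?_
  simp [matrixUnit_apply, h]

section Fintype

variable [Fintype X]

lemma sum_matrixUnit : ∑ x : X, matrixUnit x x = 1 := by
  refine LinearMap.ext fun ξ => ?_
  ext y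
  simp [LinearMap.sum_apply, matrixUnit_apply, Pi.single_apply]

lemma star_matrixUnit (x y : X) : star (matrixUnit x y) = matrixUnit y x := by
  rw [LinearMap.star_eq_adjoint, eq_comm, LinearMap.eq_adjoint_iff]
  intro ξ η
  simp [matrixUnit_apply, inner_smul_left, inner_smul_right, EuclideanSpace.inner_single_left,
    EuclideanSpace.inner_single_right, mul_comm]

end Fintype

/-- The map `S ↦ e_{x,y} ⊗ S` from `B(H, K)` to `B(ℂ^X ⊗ H, ℂ^X ⊗ K)`. -/
noncomputable def block (H : Type v) (K : Type w) [NormedAddCommGroup H] [InnerProductSpace ℂ H]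
    [NormedAddCommGroup K] [InnerProductSpace ℂ K] (x y : X) :
    (H →ₗ[ℂ] K) →ₗ[ℂ] (EuclideanSpace ℂ X ⊗[ℂ] H →ₗ[ℂ] EuclideanSpace ℂ X ⊗[ℂ] K) :=
  { toFun := fun S => TensorProduct.map (matrixUnit x y) S
    map_add' := TensorProduct.map_add_right _
    map_smul' := fun c => TensorProduct.map_smul_right c _ }

lemma block_apply (x y : X) (S : H →ₗ[ℂ] K) :
    block H K x y S = TensorProduct.map (matrixUnit x y) S := rfl

lemma block_mul_same (x y z : X) (S T : Module.End ℂ H) :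
    block H H x y S * block H H y z T = block H H x z (S * T) := by
  rw [block_apply, block_apply, block_apply, ← matrixUnit_mul_same x y z, TensorProduct.map_mul]

lemma block_mul_of_ne (x z : X) {y y' : X} (h : y ≠ y') (S T : Module.End ℂ H) :
    block H H x y S * block H H y' z T = 0 := by
  rw [block_apply, block_apply, ← TensorProduct.map_mul, matrixUnit_mul_of_ne x z h,
    TensorProduct.map_zero_left]

variable [Fintype X]

lemma star_block [FiniteDimensional ℂ H] (x y : X) (S : Module.End ℂ H) :
    star (block H H x y S) = block H H y x (star S) := by
  rw [block_apply, block_apply, LinearMap.star_eq_adjoint, TensorProduct.adjoint_map,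
    ← LinearMap.star_eq_adjoint, ← LinearMap.star_eq_adjoint, star_matrixUnit]

lemma sum_block_one : ∑ x : X, block H H x x 1 = 1 := by
  refine TensorProduct.ext' fun ξ η => ?_
  simp only [LinearMap.sum_apply, block_apply, TensorProduct.map_tmul]
  rw [← TensorProduct.sum_tmul, ← LinearMap.sum_apply, sum_matrixUnit]
  rfl

/-! ### Block sums with coefficients in an algebra: products, adjoints, homomorphisms, intertwiners.
-/

section Algebra

variable {A A' B C : Type*} [Ring A] [Algebra ℂ A] [Ring A'] [Algebra ℂ A'] [Ring B] [Algebra ℂ B]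
  [Ring C] [Algebra ℂ C]

/-- The map `S ⊗ a ↦ ∑_{x,y} (e_{x,y} ⊗ S) ⊗ f_{x,y}(a)`. -/
noncomputable def blockSum (H : Type v) (K : Type w) [NormedAddCommGroup H]
    [InnerProductSpace ℂ H] [NormedAddCommGroup K] [InnerProductSpace ℂ K]
    (f : X → X → A →ₗ[ℂ] B) :
    (H →ₗ[ℂ] K) ⊗[ℂ] A →ₗ[ℂ]
      (EuclideanSpace ℂ X ⊗[ℂ] H →ₗ[ℂ] EuclideanSpace ℂ X ⊗[ℂ] K) ⊗[ℂ] B :=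
  ∑ x, ∑ y, TensorProduct.map (block H K x y) (f x y)

lemma blockSum_tmul (f : X → X → A →ₗ[ℂ] B) (S : H →ₗ[ℂ] K) (c : A) :
    blockSum H K f (S ⊗ₜ c) = ∑ x, ∑ y, block H K x y S ⊗ₜ f x y c := by
  simp [blockSum, LinearMap.sum_apply]

/-- Matrix multiplication of blocks, for entries whose products depend only, and linearly, on `p(a)
q(b)`. It serves unitarity with `p = q = id` and the coproduct with `p`, `q` the two leg embeddings.
The maps `f`, `g` need not be multiplicative. -/
lemma blockSum_mul {f : X → X → A →ₗ[ℂ] B} {g : X → X → A' →ₗ[ℂ] B} {p : A →ₐ[ℂ] C}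
    {q : A' →ₐ[ℂ] C} {F : X → X → X → C →ₗ[ℂ] B}
    (h : ∀ x y z a b, f x y a * g y z b = F x y z (p a * q b))
    (s : Module.End ℂ H ⊗[ℂ] A) (t : Module.End ℂ H ⊗[ℂ] A') :
    blockSum H H f s * blockSum H H g t =
      blockSum H H (fun x z => ∑ y, F x y z)
        (Algebra.TensorProduct.map (AlgHom.id ℂ (Module.End ℂ H)) p s *
          Algebra.TensorProduct.map (AlgHom.id ℂ (Module.End ℂ H)) q t) := by
  induction s using TensorProduct.induction_on with
  | zero => simp only [map_zero, zero_mul]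
  | add s₁ s₂ h₁ h₂ => simp only [map_add, add_mul, h₁, h₂]
  | tmul S a =>
    induction t using TensorProduct.induction_on with
    | zero => simp only [map_zero, mul_zero]
    | add s₁ s₂ h₁ h₂ => simp only [map_add, mul_add, h₁, h₂]
    | tmul T b =>
      rw [Algebra.TensorProduct.map_tmul, Algebra.TensorProduct.map_tmul,
        Algebra.TensorProduct.tmul_mul_tmul, blockSum_tmul, blockSum_tmul, blockSum_tmul,
        Finset.sum_mul]
      refine Finset.sum_congr rfl fun x _ => ?_
      -- Since `e_{x,y} e_{y',z} = 0` for `y' ≠ y`, only the block row `y' = y` of the second factor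
      -- meets column `y` of the first.
      have key : ∀ y, block H H x y S ⊗ₜ[ℂ] f x y a * ∑ y', ∑ z, block H H y' z T ⊗ₜ[ℂ] g y' z b =
          ∑ z, block H H x z (S * T) ⊗ₜ[ℂ] F x y z (p a * q b) := fun y => by
        rw [Finset.mul_sum, Finset.sum_eq_single y]
        · rw [Finset.mul_sum]
          refine Finset.sum_congr rfl fun z _ => ?_
          rw [Algebra.TensorProduct.tmul_mul_tmul, block_mul_same, h]
        · intro y' _ hy
          rw [Finset.mul_sum]
          refine Finset.sum_eq_zero fun z _ => ?_
          rw [Algebra.TensorProduct.tmul_mul_tmul, block_mul_of_ne x z hy.symm,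
            TensorProduct.zero_tmul]
        · intro hy
          exact absurd (Finset.mem_univ y) hy
      rw [Finset.sum_mul, Finset.sum_congr rfl fun y _ => key y, Finset.sum_comm]
      refine Finset.sum_congr rfl fun z _ => ?_
      rw [← TensorProduct.tmul_sum, LinearMap.sum_apply]
      rfl

lemma blockSum_one {f : X → X → A →ₗ[ℂ] B} (h : ∀ x y, f x y 1 = if x = y then 1 else 0) :
    blockSum H H f 1 = 1 := by
  rw [Algebra.TensorProduct.one_def, blockSum_tmul, Algebra.TensorProduct.one_def, ← sum_block_one,
    TensorProduct.sum_tmul]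
  refine Finset.sum_congr rfl fun x _ => ?_
  rw [Finset.sum_eq_single x]
  · rw [h, if_pos rfl]
  · intro y _ hy
    rw [h, if_neg hy.symm, TensorProduct.tmul_zero]
  · intro hx
    exact absurd (Finset.mem_univ x) hx

/-- The adjoint sends `e_{x,y} ⊗ S` to `e_{y,x} ⊗ S^*`, so the block indices are transposed; this is
why `g` carries the swapped indices. -/
lemma star_blockSum [FiniteDimensional ℂ H] [StarRing A] [StarRing B]
    [StarModule ℂ A] [StarModule ℂ B] {f g : X → X → A →ₗ[ℂ] B}
    (h : ∀ x y a, star (f x y a) = g y x (star a)) (s : Module.End ℂ H ⊗[ℂ] A) :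
    star (blockSum H H f s) = blockSum H H g (star s) := by
  induction s using TensorProduct.induction_on with
  | zero =>
    have h0 : blockSum H H g (star 0) = 0 :=
      (congrArg (blockSum H H g) (star_zero _)).trans (map_zero _)
    rw [h0]
    exact (congrArg star (map_zero (blockSum H H f))).trans
      (star_zero (Module.End ℂ (EuclideanSpace ℂ X ⊗[ℂ] H) ⊗[ℂ] B))
  | add s₁ s₂ h₁ h₂ =>
    have h0 : blockSum H H g (star (s₁ + s₂)) =
        blockSum H H g (star s₁) + blockSum H H g (star s₂) :=
      (congrArg (blockSum H H g) (star_add _ _)).trans (map_add _ _ _)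
    rw [h0, ← h₁, ← h₂]
    exact (congrArg star (map_add (blockSum H H f) _ _)).trans
      (star_add (R := Module.End ℂ (EuclideanSpace ℂ X ⊗[ℂ] H) ⊗[ℂ] B) _ _)
  | tmul S a =>
    -- The double sum is interchanged so that the `(x,y)` term of the original sum faces its
    -- adjoint, the `(y,x)` term.
    have h0 : blockSum H H g (star (S ⊗ₜ a)) =
        ∑ x, ∑ y, block H H y x (star S) ⊗ₜ[ℂ] g y x (star a) :=
      (congrArg (blockSum H H g) (TensorProduct.star_tmul _ _)).trans <|
        (blockSum_tmul g _ _).trans Finset.sum_comm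
    rw [h0]
    refine (congrArg star (blockSum_tmul f S a)).trans <|
      (star_sum (R := Module.End ℂ (EuclideanSpace ℂ X ⊗[ℂ] H) ⊗[ℂ] B) _ _).trans <|
      Finset.sum_congr rfl fun x _ =>
      (star_sum (R := Module.End ℂ (EuclideanSpace ℂ X ⊗[ℂ] H) ⊗[ℂ] B) _ _).trans <|
      Finset.sum_congr rfl fun y _ => ?_
    exact (TensorProduct.star_tmul _ _).trans <|
      congrArg₂ (· ⊗ₜ[ℂ] ·) (star_block x y S) (h x y a)

lemma map_blockSum (f : X → X → A →ₗ[ℂ] B) (φ : B →ₐ[ℂ] C) (s : Module.End ℂ H ⊗[ℂ] A) :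
    Algebra.TensorProduct.map (AlgHom.id ℂ (Module.End ℂ (EuclideanSpace ℂ X ⊗[ℂ] H))) φ
      (blockSum H H f s) = blockSum H H (fun x y => φ.toLinearMap ∘ₗ f x y) s := by
  induction s using TensorProduct.induction_on with
  | zero => simp only [map_zero]
  | add s₁ s₂ h₁ h₂ => simp only [map_add, h₁, h₂]
  | tmul S a =>
    simp only [blockSum_tmul, map_sum]
    rfl

lemma blockSum_map (f : X → X → B →ₗ[ℂ] C) (φ : A →ₐ[ℂ] B) (s : Module.End ℂ H ⊗[ℂ] A) :
    blockSum H H f (Algebra.TensorProduct.map (AlgHom.id ℂ (Module.End ℂ H)) φ s) =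
      blockSum H H (fun x y => f x y ∘ₗ φ.toLinearMap) s := by
  induction s using TensorProduct.induction_on with
  | zero => simp only [map_zero]
  | add s₁ s₂ h₁ h₂ => simp only [map_add, h₁, h₂]
  | tmul S a =>
    rw [Algebra.TensorProduct.map_tmul, blockSum_tmul, blockSum_tmul]
    rfl

/-- If `Δ f_{x,z} = ∑_y F_{x,z,y} Δ` and `F_{x,z,y}(p(a) q(b)) = p(f_{x,y}(a)) q(f_{y,z}(b))`, then
the relation `(id ⊗ Δ)(u) = (id ⊗ p)(u) (id ⊗ q)(u)` passes to the block sum of `u` over `f`. -/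
lemma map_blockSum_eq_mul {f : X → X → A →ₗ[ℂ] A} {F : X → X → X → C →ₗ[ℂ] C} {Δ p q : A →ₐ[ℂ] C}
    (hΔ : ∀ x z a, Δ (f x z a) = ∑ y, F x z y (Δ a))
    (hF : ∀ x y z a b, p (f x y a) * q (f y z b) = F x z y (p a * q b))
    {u : Module.End ℂ H ⊗[ℂ] A}
    (hu : Algebra.TensorProduct.map (AlgHom.id ℂ (Module.End ℂ H)) Δ u =
      Algebra.TensorProduct.map (AlgHom.id ℂ (Module.End ℂ H)) p u *
        Algebra.TensorProduct.map (AlgHom.id ℂ (Module.End ℂ H)) q u) :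
    Algebra.TensorProduct.map (AlgHom.id ℂ (Module.End ℂ (EuclideanSpace ℂ X ⊗[ℂ] H))) Δ
        (blockSum H H f u) =
      Algebra.TensorProduct.map (AlgHom.id ℂ (Module.End ℂ (EuclideanSpace ℂ X ⊗[ℂ] H))) p
          (blockSum H H f u) *
        Algebra.TensorProduct.map (AlgHom.id ℂ (Module.End ℂ (EuclideanSpace ℂ X ⊗[ℂ] H))) q
          (blockSum H H f u) := by
  have h : (fun x z => Δ.toLinearMap ∘ₗ f x z) =
      fun x z => (∑ y, F x z y) ∘ₗ Δ.toLinearMap := by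
    funext x z
    refine LinearMap.ext fun a => (hΔ x z a).trans ?_
    exact (LinearMap.sum_apply _ _ _).symm
  -- `Δ` is first absorbed into the entries, moved past them by `h`, and then released onto `u`
  -- itself, where `hu` applies.
  rw [map_blockSum, map_blockSum, map_blockSum, h, ← blockSum_map, hu]
  -- Here `F` takes the two outer letters first and the summed middle letter last, whereas
  -- `blockSum_mul` expects the middle letter in second place.
  exact (blockSum_mul (F := fun x y z => F x z y) hF u u).symm

/-- On elementary tensors this is `(id ⊗ T)(e_{x,y} ⊗ S) = e_{x,y} ⊗ TS`. With the companion for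
composition on the right, both sides of an intertwining relation become block sums of rectangular
blocks. -/
lemma rTensor_compRight_blockSum (f : X → X → A →ₗ[ℂ] B) (T : H →ₗ[ℂ] K)
    (s : Module.End ℂ H ⊗[ℂ] A) :
    LinearMap.rTensor B (LinearMap.compRight ℂ (LinearMap.lTensor (EuclideanSpace ℂ X) T) :
        Module.End ℂ (EuclideanSpace ℂ X ⊗[ℂ] H) →ₗ[ℂ] _) (blockSum H H f s) =
      blockSum H K f (LinearMap.rTensor A
        (LinearMap.compRight ℂ T : Module.End ℂ H →ₗ[ℂ] (H →ₗ[ℂ] K)) s) := by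
  induction s using TensorProduct.induction_on with
  | zero => simp only [map_zero]
  | add s₁ s₂ h₁ h₂ => simp only [map_add, h₁, h₂]
  | tmul S a =>
    simp only [LinearMap.rTensor_tmul, blockSum_tmul, map_sum]
    refine Finset.sum_congr rfl fun x _ => Finset.sum_congr rfl fun y _ => ?_
    congr 1
    exact TensorProduct.ext' fun ξ η => rfl

lemma rTensor_lcomp_blockSum (f : X → X → A →ₗ[ℂ] B) (T : H →ₗ[ℂ] K)
    (s : Module.End ℂ K ⊗[ℂ] A) :
    LinearMap.rTensor B (LinearMap.lcomp ℂ (EuclideanSpace ℂ X ⊗[ℂ] K)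
        (LinearMap.lTensor (EuclideanSpace ℂ X) T) :
        Module.End ℂ (EuclideanSpace ℂ X ⊗[ℂ] K) →ₗ[ℂ] _) (blockSum K K f s) =
      blockSum H K f (LinearMap.rTensor A
        (LinearMap.lcomp ℂ K T : Module.End ℂ K →ₗ[ℂ] (H →ₗ[ℂ] K)) s) := by
  induction s using TensorProduct.induction_on with
  | zero => simp only [map_zero]
  | add s₁ s₂ h₁ h₂ => simp only [map_add, h₁, h₂]
  | tmul S a =>
    simp only [LinearMap.rTensor_tmul, blockSum_tmul, map_sum]
    refine Finset.sum_congr rfl fun x _ => Finset.sum_congr rfl fun y _ => ?_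
    congr 1
    exact TensorProduct.ext' fun ξ η => rfl

end Algebra

/-! ### Matrix entries, and how they determine an element. -/

section Coeff

variable {A B : Type*} [CStarAlgebra A] [CStarAlgebra B]

/-- Pairing with `e_x` and `e_y` selects the `(x,y)` block, as `⟨e_x, e_{x',y'} e_y⟩ = δ_{x,x'}
δ_{y,y'}`. The vectors of `H` are arbitrary, which later makes the choice of basis immaterial. -/
lemma coeff_blockSum (f : X → X → A →ₗ[ℂ] B) (x y : X) (ξ η : H) (s : Module.End ℂ H ⊗[ℂ] A) :
    coeff (EuclideanSpace.single x (1 : ℂ) ⊗ₜ[ℂ] ξ) (EuclideanSpace.single y (1 : ℂ) ⊗ₜ[ℂ] η)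
      (blockSum H H f s) = f x y (coeff ξ η s) := by
  induction s using TensorProduct.induction_on with
  | zero => simp only [map_zero]
  | add s₁ s₂ h₁ h₂ => simp only [map_add, h₁, h₂]
  | tmul S a =>
    rw [blockSum_tmul, map_sum, Finset.sum_eq_single x]
    · rw [map_sum, Finset.sum_eq_single y]
      · rw [coeff_tmul, coeff_tmul, block_apply, TensorProduct.map_tmul, TensorProduct.inner_tmul,
          matrixUnit_apply, map_smul]
        simp
      · intro y' _ hy
        rw [coeff_tmul, block_apply, TensorProduct.map_tmul, matrixUnit_apply]
        simp [hy]
      · intro hy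
        exact absurd (Finset.mem_univ y) hy
    · intro x' _ hx
      rw [map_sum]
      refine Finset.sum_eq_zero fun y' _ => ?_
      rw [coeff_tmul, block_apply, TensorProduct.map_tmul, TensorProduct.inner_tmul,
        matrixUnit_apply]
      by_cases hy : y' = y <;> simp [EuclideanSpace.inner_single_left, hx.symm, hy]
    · intro hx
      exact absurd (Finset.mem_univ x) hx

/-- Expansion in the matrix units `|b_i⟩⟨b_j|`: by linearity it reduces to `S b_j = ∑_i ⟨b_i, S b_j⟩
b_i`. Consequently the matrix entries determine `s`. -/
lemma sum_tmul_coeff {ι : Type*} [Fintype ι] (b : OrthonormalBasis ι ℂ H)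
    (s : Module.End ℂ H ⊗[ℂ] A) :
    ∑ i, ∑ j, ((innerₛₗ ℂ (b j)).smulRight (b i) : Module.End ℂ H) ⊗ₜ[ℂ]
      coeff (b i) (b j) s = s := by
  induction s using TensorProduct.induction_on with
  | zero => simp only [map_zero, TensorProduct.tmul_zero, Finset.sum_const_zero]
  | add s₁ s₂ h₁ h₂ =>
    simp only [map_add, TensorProduct.tmul_add, Finset.sum_add_distrib]
    rw [h₁, h₂]
  | tmul S a =>
    simp only [coeff_tmul, TensorProduct.tmul_smul, TensorProduct.smul_tmul',
      ← TensorProduct.sum_tmul]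
    congr 1
    refine b.toBasis.ext fun j => ?_
    classical
    simp only [LinearMap.sum_apply, LinearMap.smul_apply, LinearMap.smulRight_apply,
      OrthonormalBasis.coe_toBasis, innerₛₗ_apply_apply, b.inner_eq_ite, ite_smul, one_smul,
      zero_smul, smul_ite, smul_zero, Finset.sum_ite_eq', Finset.mem_univ,
      if_true]
    exact b.sum_repr' (S (b j))

lemma ext_coeff {ι : Type*} [Fintype ι] (b : OrthonormalBasis ι ℂ H)
    {s t : Module.End ℂ H ⊗[ℂ] A} (h : ∀ i j, coeff (b i) (b j) s = coeff (b i) (b j) t) :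
    s = t := by
  rw [← sum_tmul_coeff b s, ← sum_tmul_coeff b t]
  simp only [h]

/-- Slicing the second leg with evaluation at `y` recovers the coefficient of `e_y`. -/
lemma sum_tmul_single_injective {c d : X → A}
    (h : ∑ y, c y ⊗ₜ[ℂ] (Pi.single y 1 : X → ℂ) = ∑ y, d y ⊗ₜ[ℂ] Pi.single y 1) : c = d := by
  funext y
  have key : ∀ c : X → A, TensorProduct.rid ℂ A (LinearMap.lTensor A
      (LinearMap.proj y : (X → ℂ) →ₗ[ℂ] ℂ) (∑ y, c y ⊗ₜ[ℂ] Pi.single y 1)) = c y := fun c => by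
    rw [map_sum, map_sum, Finset.sum_eq_single y]
    · simp
    · intro y' _ hy
      simp [hy]
    · intro hy
      exact absurd (Finset.mem_univ y) hy
  rw [← key c, h, key]

end Coeff

end BlockSum

/-! ### The representation `ψ(u)`. -/

namespace TreeAlg

variable {X : Type u} [Fintype X] [DecidableEq X]
variable {H : Type v} [NormedAddCommGroup H] [InnerProductSpace ℂ H]
variable {K : Type w} [NormedAddCommGroup K] [InnerProductSpace ℂ K]

/-- `ψ_{x,y}` as a linear map. -/
noncomputable def psiEntryₗ (x y : X) : TreeAlg X →ₗ[ℂ] TreeAlg X :=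
  (psiEntry x y : TreeAlg X →ₗ[ℂ] TreeAlg X)

/-- The element `ψ(u)` of `B(ℂ^X ⊗ H) ⊗ 𝔸_X`. -/
noncomputable def psiRep (u : Module.End ℂ H ⊗[ℂ] TreeAlg X) :
    Module.End ℂ (EuclideanSpace ℂ X ⊗[ℂ] H) ⊗[ℂ] TreeAlg X :=
  blockSum H H psiEntryₗ u

lemma coeff_psiRep (x y : X) (ξ η : H) (u : Module.End ℂ H ⊗[ℂ] TreeAlg X) :
    coeff (EuclideanSpace.single x (1 : ℂ) ⊗ₜ[ℂ] ξ) (EuclideanSpace.single y (1 : ℂ) ⊗ₜ[ℂ] η)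
      (psiRep u) = psiEntry x y (coeff ξ η u) :=
  coeff_blockSum _ x y ξ η u

lemma isPsiOf_psiRep {ι : Type*} [Fintype ι] (b : OrthonormalBasis ι ℂ H)
    (u : Module.End ℂ H ⊗[ℂ] TreeAlg X) : IsPsiOf b u (psiRep u) := fun x i j =>
  (psi_single x _).trans <| Finset.sum_congr rfl fun y _ =>
    congrArg (· ⊗ₜ[ℂ] Pi.single y 1) (coeff_psiRep x y (b i) (b j) u).symm

/-- Comparing coefficients of `e_y` in the relations fixes every entry of `w` in the orthonormal
basis `(e_x ⊗ b_i)`, and `psiRep u` satisfies the same relations. -/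
lemma _root_.IsPsiOf.eq_psiRep {ι : Type*} [Fintype ι] {b : OrthonormalBasis ι ℂ H}
    {u : Module.End ℂ H ⊗[ℂ] TreeAlg X}
    {w : Module.End ℂ (EuclideanSpace ℂ X ⊗[ℂ] H) ⊗[ℂ] TreeAlg X} (h : IsPsiOf b u w) :
    w = psiRep u := by
  refine ext_coeff ((EuclideanSpace.basisFun X ℂ).tensorProduct b) ?_
  rintro ⟨x, i⟩ ⟨y, j⟩
  simp only [OrthonormalBasis.tensorProduct_apply, EuclideanSpace.basisFun_apply]
  exact congrFun (sum_tmul_single_injective ((h x i j).symm.trans (isPsiOf_psiRep b u x i j))) y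

lemma star_psiRep [FiniteDimensional ℂ H] (u : Module.End ℂ H ⊗[ℂ] TreeAlg X) :
    star (psiRep u) = blockSum H H (fun x y => psiEntryₗ y x) (star u) :=
  star_blockSum (fun x y b => (map_star (psiEntry x y) b).symm) u

lemma psiRep_mul_star [FiniteDimensional ℂ H] {u : Module.End ℂ H ⊗[ℂ] TreeAlg X}
    (hu : u * star u = 1) : psiRep u * star (psiRep u) = 1 := by
  -- The adjoint has `ψ_{z,y}` in position `(y,z)`, so the entries multiplied are `ψ_{x,y}(b)
  -- ψ_{z,y}(c)`: zero for `x ≠ z` by column orthogonality, and `ψ_{x,y}(bc)` for `x = z`.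
  have h := blockSum_mul (H := H) (f := psiEntryₗ (X := X)) (g := fun x y => psiEntryₗ y x)
    (p := AlgHom.id ℂ _) (q := AlgHom.id ℂ _)
    (F := fun x y z => if x = z then psiEntryₗ x y else 0)
    (fun x y z b c => by
      split_ifs with hxz
      · subst hxz
        exact (map_mul (psiEntry x y) b c).symm
      · exact psiEntry_mul_psiEntry hxz y b c) u (star u)
  rw [Algebra.TensorProduct.map_id, AlgHom.id_apply, AlgHom.id_apply, hu] at h
  rw [star_psiRep]
  refine h.trans (blockSum_one fun x z => ?_)
  rw [LinearMap.sum_apply]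
  split_ifs
  -- On the diagonal, `∑_y ψ_{x,y}(1)` is a row sum of the magic unitary.
  · exact (Finset.sum_congr rfl fun y _ => psiEntry_one x y).trans (sum_letter_right x)
  · exact Finset.sum_const_zero

lemma star_psiRep_mul [FiniteDimensional ℂ H] {u : Module.End ℂ H ⊗[ℂ] TreeAlg X}
    (hu : star u * u = 1) : star (psiRep u) * psiRep u = 1 := by
  -- Now the entries multiplied are `ψ_{y,x}(b) ψ_{y,z}(c)`, so row orthogonality applies and the
  -- diagonal yields column sums.
  have h := blockSum_mul (H := H) (f := fun x y => psiEntryₗ y x) (g := psiEntryₗ (X := X))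
    (p := AlgHom.id ℂ _) (q := AlgHom.id ℂ _)
    (F := fun x y z => if x = z then psiEntryₗ y x else 0)
    (fun x y z b c => by
      split_ifs with hxz
      · subst hxz
        exact (map_mul (psiEntry y x) b c).symm
      · exact psiEntry_mul_psiEntry_row y hxz b c) (star u) u
  rw [Algebra.TensorProduct.map_id, AlgHom.id_apply, AlgHom.id_apply, hu] at h
  rw [star_psiRep]
  refine h.trans (blockSum_one fun x z => ?_)
  rw [LinearMap.sum_apply]
  split_ifs
  · exact (Finset.sum_congr rfl fun y _ => psiEntry_one y x).trans (sum_letter_left x)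
  · exact Finset.sum_const_zero

/-- The hypothesis `hF` of `map_blockSum_eq_mul` in the case of `ψ`; the middle letter `y` is the
last argument of `psiEntryTensor`. -/
lemma inl_psiEntry_mul_inr_psiEntry (x y z : X) (b c : TreeAlg X) :
    MinTensor.inl (psiEntry x y b) * MinTensor.inr (psiEntry y z c) =
      psiEntryTensor x z y (MinTensor.inl b * MinTensor.inr c) := by
  have h := MinTensor.inl_mul_inr b c
  have h' := MinTensor.inl_mul_inr (psiEntry x y b) (psiEntry y z c)
  exact h'.trans <| (psiEntryTensor_of_tmul x z y b c).symm.trans <|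
    congrArg (psiEntryTensor x z y) h.symm

lemma comul_psiRep {u : Module.End ℂ H ⊗[ℂ] TreeAlg X}
    (hu : Algebra.TensorProduct.map (AlgHom.id ℂ (Module.End ℂ H)) (comul X).toAlgHom u =
      Algebra.TensorProduct.map (AlgHom.id ℂ (Module.End ℂ H)) MinTensor.inl u *
        Algebra.TensorProduct.map (AlgHom.id ℂ (Module.End ℂ H)) MinTensor.inr u) :
    Algebra.TensorProduct.map (AlgHom.id ℂ (Module.End ℂ (EuclideanSpace ℂ X ⊗[ℂ] H)))
        (comul X).toAlgHom (psiRep u) =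
      Algebra.TensorProduct.map (AlgHom.id ℂ _) MinTensor.inl (psiRep u) *
        Algebra.TensorProduct.map (AlgHom.id ℂ _) MinTensor.inr (psiRep u) :=
  map_blockSum_eq_mul (A := TreeAlg X) (C := MinTensor (TreeAlg X) (TreeAlg X)) (f := psiEntryₗ)
    (F := psiEntryTensor) (Δ := (comul X).toAlgHom) (p := MinTensor.inl) (q := MinTensor.inr)
    comul_psiEntry inl_psiEntry_mul_inr_psiEntry hu

lemma isUnitaryRep_psiRep [FiniteDimensional ℂ H] {u : Module.End ℂ H ⊗[ℂ] TreeAlg X}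
    (hu : IsUnitaryRep (comul X) u) : IsUnitaryRep (comul X) (psiRep u) :=
  ⟨Unitary.mem_iff.2 ⟨star_psiRep_mul (Unitary.mem_iff.1 hu.1).1,
    psiRep_mul_star (Unitary.mem_iff.1 hu.1).2⟩, comul_psiRep hu.2⟩

lemma _root_.IsIntertwiner.psiRep {u : Module.End ℂ H ⊗[ℂ] TreeAlg X}
    {v : Module.End ℂ K ⊗[ℂ] TreeAlg X} {T : H →ₗ[ℂ] K} (h : IsIntertwiner T u v) :
    IsIntertwiner (LinearMap.lTensor (EuclideanSpace ℂ X) T) (psiRep u) (psiRep v) :=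
  (rTensor_compRight_blockSum _ T u).trans <|
    (congrArg (blockSum H K psiEntryₗ) h).trans (rTensor_lcomp_blockSum _ T v).symm

end TreeAlg

theorem mainTheorem4 {X : Type u} [Fintype X] [DecidableEq X] :
    -- existence and uniqueness of the unitary representation `ψ(u)` on `ℂ^X ⊗ H`
    (∀ (H : Type v) [NormedAddCommGroup H] [InnerProductSpace ℂ H] [FiniteDimensional ℂ H]
      (u : Module.End ℂ H ⊗[ℂ] TreeAlg X), IsUnitaryRep (TreeAlg.comul X) u →
      ∃ w : Module.End ℂ (EuclideanSpace ℂ X ⊗[ℂ] H) ⊗[ℂ] TreeAlg X,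
        IsUnitaryRep (TreeAlg.comul X) w ∧
        (∀ (d : ℕ) (b : OrthonormalBasis (Fin d) ℂ H), IsPsiOf b u w) ∧
        (∀ (d : ℕ) (b : OrthonormalBasis (Fin d) ℂ H)
          (w' : Module.End ℂ (EuclideanSpace ℂ X ⊗[ℂ] H) ⊗[ℂ] TreeAlg X),
          IsPsiOf b u w' → w' = w)) ∧
    -- if `T` intertwines `u` and `v`, then `id ⊗ T` intertwines `ψ(u)` and `ψ(v)`
    (∀ (H : Type v) [NormedAddCommGroup H] [InnerProductSpace ℂ H] [FiniteDimensional ℂ H]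
      (K : Type w) [NormedAddCommGroup K] [InnerProductSpace ℂ K] [FiniteDimensional ℂ K]
      (u : Module.End ℂ H ⊗[ℂ] TreeAlg X) (v : Module.End ℂ K ⊗[ℂ] TreeAlg X),
      IsUnitaryRep (TreeAlg.comul X) u → IsUnitaryRep (TreeAlg.comul X) v →
      ∀ (d d' : ℕ) (b : OrthonormalBasis (Fin d) ℂ H) (c : OrthonormalBasis (Fin d') ℂ K)
        (u' : Module.End ℂ (EuclideanSpace ℂ X ⊗[ℂ] H) ⊗[ℂ] TreeAlg X)
        (v' : Module.End ℂ (EuclideanSpace ℂ X ⊗[ℂ] K) ⊗[ℂ] TreeAlg X),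
        IsPsiOf b u u' → IsPsiOf c v v' →
        ∀ T : H →ₗ[ℂ] K, IsIntertwiner T u v →
          IsIntertwiner (LinearMap.lTensor (EuclideanSpace ℂ X) T) u' v') := by
  refine ⟨fun H _ _ _ u hu => ⟨TreeAlg.psiRep u, TreeAlg.isUnitaryRep_psiRep hu,
    fun _ b => TreeAlg.isPsiOf_psiRep b u, fun _ _ _ h => h.eq_psiRep⟩, ?_⟩
  intro H _ _ _ K _ _ _ u v _ _ _ _ b c u' v' hu' hv' T hT
  -- By uniqueness, `u'` and `v'` are the basis-free elements `psiRep u` and `psiRep v`, whichever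
  -- bases were used to characterise them.
  rw [hu'.eq_psiRep, hv'.eq_psiRep]
  exact hT.psiRep
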